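/- In the spherical 3-space $\mathbb S^3$ there exists a tiling composed of twelve congruent polyhedral tiles that possesses a nontrivial continuous deformation such that, in the course of the deformation, the dihedral angles of every tile are left fixed and the deformed tiles form, at every moment, a tiling of $\mathbb S^3$ composed of congruent polyhedral tiles again. Here a polyhedral tile is the closure of a domain in $\mathbb S^3$ bounded by a sphere-homeomorphic polyhedral surface without self-intersections (whose faces may be triangulated). Sets tile $\mathbb S^3$ if they cover it and have pairwise disjoint interiors. A continuous deformation is one under which the combinatorial structure of the boundary surface of each tile is kept and its vertices move continuously, all faces remaining geodesic polygons; it is nontrivial if it is not generated by isometries of $\mathbb S^3$, namely if at some moment the tiles are not congruent to the original ones. -/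

import Mathlib

open Set Filter Topology

/-- The Euclidean space `ℝ⁴`. -/
abbrev E4 : Type := EuclideanSpace ℝ (Fin 4)

/-- The spherical 3-space: the standard unit sphere of `ℝ⁴`. -/
abbrev S3 : Type := Metric.sphere (0 : E4) 1

/-- Two subsets of `S³` are congruent if an isometry of `S³`, i.e. the restriction of an element
of `O(4)`, carries one onto the other. -/
def CongruentSets (A B : Set S3) : Prop :=
  ∃ g : E4 ≃ₗᵢ[ℝ] E4, (fun x : S3 => g (x : E4)) '' A = (fun x : S3 => (x : E4)) '' B

/-! ### Triangulated 2-spheres (combinatorial part) -/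

section Combinatorics

variable {n : ℕ}

/-- The edges of a set `F` of triangles on the vertex set `Fin n`. -/
def edges (F : Finset (Finset (Fin n))) : Finset (Finset (Fin n)) :=
  F.biUnion fun f => f.powersetCard 2

/-- The graph formed by the vertices and the edges. -/
def edgeGraph (F : Finset (Finset (Fin n))) : SimpleGraph (Fin n) where
  Adj a b := a ≠ b ∧ {a, b} ∈ edges F
  symm := ⟨fun a b h => ⟨h.1.symm, by rw [Finset.pair_comm]; exact h.2⟩⟩
  loopless := ⟨fun _ h => h.1 rfl⟩

/-- The link of the vertex `v`: the edges opposite to `v` in the triangles that contain `v`. -/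
def linkGraph (F : Finset (Finset (Fin n))) (v : Fin n) : SimpleGraph (Fin n) where
  Adj a b := a ≠ b ∧ {v, a, b} ∈ F
  symm := ⟨fun a b h => ⟨h.1.symm, by rw [Finset.pair_comm b a]; exact h.2⟩⟩
  loopless := ⟨fun _ h => h.1 rfl⟩

/-- `F` is (the set of triangles of) a triangulation of the 2-sphere with vertex set `Fin n`:
a connected closed triangulated surface of Euler characteristic `2`. -/
structure IsTriangulatedSphere (F : Finset (Finset (Fin n))) : Prop where
  /-- every face is a triangle -/
  card_face : ∀ f ∈ F, f.card = 3
  /-- the surface has no boundary: every edge lies in exactly two triangles -/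
  two_faces : ∀ e ∈ edges F, (F.filter fun f => e ⊆ f).card = 2
  /-- the link of every vertex is connected (hence it is a single cycle) -/
  link_connected : ∀ v a b : Fin n, {v, a} ∈ edges F → {v, b} ∈ edges F →
    (linkGraph F v).Reachable a b
  /-- the surface is connected -/
  connected : (edgeGraph F).Connected
  /-- the Euler characteristic is two -/
  euler : (n : ℤ) - (edges F).card + F.card = 2

end Combinatorics

/-! ### Polyhedral tiles in the spherical 3-space -/

/-- The spherical simplex spanned by the points `p v`, `v ∈ s`: the part of `S³` in the convex cone
generated by these points. -/
def sphericalSimplex {n : ℕ} (p : Fin n → S3) (s : Finset (Fin n)) : Set S3 :=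
  {x | ∃ c : Fin n → ℝ, (∀ v ∈ s, 0 ≤ c v) ∧ (x : E4) = ∑ v ∈ s, c v • (p v : E4)}

/-- `K` is a solid polyhedron in `S³` whose boundary is the polyhedral surface without
self-intersections that has the combinatorial structure `F` and the vertices `p v`.
(A face with more than three vertices is represented by a triangulation of it.) -/
structure IsPolyhedralTile {n : ℕ} (F : Finset (Finset (Fin n))) (p : Fin n → S3)
    (K : Set S3) : Prop where
  /-- every face is a nondegenerate spherical triangle -/
  nondegenerate : ∀ f ∈ F, LinearIndependent ℝ (fun v : f => (p v : E4))
  /-- two faces meet exactly in their common vertex or edge, if they have one, and are otherwise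
  disjoint: the surface has no self-intersections -/
  embedded : ∀ f ∈ F, ∀ g ∈ F,
    sphericalSimplex p f ∩ sphericalSimplex p g = sphericalSimplex p (f ∩ g)
  /-- `K` is the closure of its interior -/
  regular : closure (interior K) = K
  /-- the boundary of `K` is the surface -/
  frontier_eq : frontier K = ⋃ f ∈ F, sphericalSimplex p f

/-- `α` is the dihedral angle, measured inside the solid `K`, at the edge `ab` between the faces
`abc` and `abd`. Here `u` and `cos α • u + sin α • v` are the unit vectors which are orthogonal to
the edge and point from it into the faces `abc` and `abd`; turning from the first to the second
through the angle `α`, one passes exactly through directions that point, from the midpoint of the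
edge, into the interior of `K`. The angle may exceed `π`. -/
def HasDihedralAngle (K : Set S3) (a b c d : S3) (α : ℝ) : Prop :=
  0 < α ∧ α < 2 * Real.pi ∧
  ∃ u v : E4, ‖u‖ = 1 ∧ ‖v‖ = 1 ∧ inner ℝ u v = 0 ∧
    inner ℝ u (a : E4) = 0 ∧ inner ℝ u (b : E4) = 0 ∧
    inner ℝ v (a : E4) = 0 ∧ inner ℝ v (b : E4) = 0 ∧
    (∃ k l m : ℝ, 0 < m ∧ (c : E4) = k • (a : E4) + l • (b : E4) + m • u) ∧
    (∃ k l m : ℝ, 0 < m ∧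
      (d : E4) = k • (a : E4) + l • (b : E4) + m • (Real.cos α • u + Real.sin α • v)) ∧
    ∀ θ ∈ Ioo 0 α, ∀ᶠ s : ℝ in 𝓝[>] 0, ∃ x ∈ interior K, ∃ r : ℝ, 0 < r ∧
      (x : E4) = r • ((a : E4) + (b : E4) + s • (Real.cos θ • u + Real.sin θ • v))

/-- The sets `K i` tile `S³`: they cover it and have pairwise disjoint interiors. -/
def IsTiling {ι : Type*} (K : ι → Set S3) : Prop :=
  (⋃ i, K i) = univ ∧ Pairwise fun i j => Disjoint (interior (K i)) (interior (K j))

namespace FlexibleTiling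

/-! Regard `S³` as the join of two orthogonal great circles: the axis, in the plane of coordinates 0
and 1, and the dual circle, in the plane of coordinates 2 and 3. Cutting the dual circle into twelve
arcs of length `π / 6` cuts `S³` into twelve congruent lunes that share the axis. Now take the part
of `S³` over the first quadrant of the axis plane and rotate it by an angle `s` in the dual plane.
Over the quadrant and over its complement the pieces are still twelve consecutive sectors, so for
every `s` they tile `S³` (`isTiling_tile`), and rotations of the dual plane permute them
(`congruentSets_tile`). For `0 < s < π / 6` the two parts of each lune overlap along the cut, and
the tile is bounded by an embedded sphere with seven vertices (`isPolyhedralTile`).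

The dihedral angles do not see `s`. Faces of sector type lie in great spheres through the axis and
meet along it at `π / 6`; the walls opened by the rotation lie in the great spheres `x 0 = 0` and `x
1 = 0`, which are orthogonal to each other and to every great sphere through the axis. Hence the
other angles are `π / 2`, `3π / 2`, or `π` at an edge that only subdivides a flat face
(`exists_dihedralAngle`).

The shape does see `s`. The axis consists exactly of the points of the tile whose antipodes also
belong to the tile, so a congruence must respect the axis and its orthogonal circle. The tile meets
that circle in an arc of length `s + π / 6`, which grows with `s` (`not_congruentSets_tile`). -/

/-! ### Coordinates in `ℝ⁴`. -/

/-- The vector of `ℝ⁴` with given coordinates. -/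
noncomputable def vec (a b c d : ℝ) : E4 := !₂[a, b, c, d]

@[simp] lemma vec_zero (a b c d : ℝ) : vec a b c d 0 = a := rfl
@[simp] lemma vec_one (a b c d : ℝ) : vec a b c d 1 = b := rfl
@[simp] lemma vec_two (a b c d : ℝ) : vec a b c d 2 = c := rfl
@[simp] lemma vec_three (a b c d : ℝ) : vec a b c d 3 = d := rfl

lemma ext_coord {x y : E4} (h0 : x 0 = y 0) (h1 : x 1 = y 1) (h2 : x 2 = y 2) (h3 : x 3 = y 3) :
    x = y := by
  ext i; fin_cases i <;> assumption

lemma inner_coord (x y : E4) :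
    inner ℝ x y = x 0 * y 0 + x 1 * y 1 + x 2 * y 2 + x 3 * y 3 := by
  simp only [PiLp.inner_apply, Fin.sum_univ_four, RCLike.inner_apply, conj_trivial]
  ring

lemma norm_sq_coord (x : E4) : ‖x‖ ^ 2 = x 0 ^ 2 + x 1 ^ 2 + x 2 ^ 2 + x 3 ^ 2 := by
  rw [← real_inner_self_eq_norm_sq, inner_coord]; ring

lemma norm_eq_one_of_coord {x : E4} (h : x 0 ^ 2 + x 1 ^ 2 + x 2 ^ 2 + x 3 ^ 2 = 1) : ‖x‖ = 1 := by
  rw [← norm_sq_coord] at h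
  nlinarith [norm_nonneg x]

lemma coord_sq_sum (x : S3) :
    (x : E4) 0 ^ 2 + (x : E4) 1 ^ 2 + (x : E4) 2 ^ 2 + (x : E4) 3 ^ 2 = 1 := by
  rw [← norm_sq_coord, norm_eq_of_mem_sphere x]; norm_num

/-! ### Half-spaces and sectors bounded by great spheres through the axis. -/

/-- The unit vector at angle `γ` in the plane of the last two coordinates. -/
noncomputable def ray (γ : ℝ) : E4 := vec 0 0 (Real.cos γ) (Real.sin γ)

/-- The signed area spanned by `ray γ` and the last two coordinates of `x`. -/
noncomputable def turn (γ : ℝ) (x : E4) : ℝ := Real.cos γ * x 3 - Real.sin γ * x 2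

lemma turn_add (γ : ℝ) (x y : E4) : turn γ (x + y) = turn γ x + turn γ y := by
  simp [turn]; ring

lemma turn_smul (γ r : ℝ) (x : E4) : turn γ (r • x) = r * turn γ x := by
  simp [turn]; ring

lemma turn_ray (γ β : ℝ) : turn γ (ray β) = Real.sin (β - γ) := by
  simp [turn, ray, Real.sin_sub]; ring

lemma continuous_turn (γ : ℝ) : Continuous (turn γ) := by
  unfold turn; fun_prop

/-- The linear dependence of three rays in a plane, paired with `x`. With known signs of the sines
it transfers sign conditions from the two sides of one sector to any other ray; all comparisons
between the base sector and the shifted one go through it. -/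
lemma turn_relation (α β γ : ℝ) (x : E4) :
    Real.sin (β - α) * turn γ x = Real.sin (β - γ) * turn α x + Real.sin (γ - α) * turn β x := by
  simp only [turn, Real.sin_sub]
  have := Real.sin_sq_add_cos_sq γ
  ring_nf

lemma planar_expansion_two (α β : ℝ) (x : E4) :
    Real.sin (β - α) * x 2 = turn α x * Real.cos β - turn β x * Real.cos α := by
  simp only [turn, Real.sin_sub]; ring

lemma planar_expansion_three (α β : ℝ) (x : E4) :
    Real.sin (β - α) * x 3 = turn α x * Real.sin β - turn β x * Real.sin α := by
  simp only [turn, Real.sin_sub]; ring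

/-- The closed sector between two rays consists of the nonnegative combinations of them. -/
lemma exists_sector_coeffs {α β : ℝ} (h : 0 < Real.sin (β - α)) {x : E4} (ha : 0 ≤ turn α x)
    (hb : turn β x ≤ 0) : ∃ a b : ℝ, 0 ≤ a ∧ 0 ≤ b ∧
      x 2 = a * Real.cos α + b * Real.cos β ∧ x 3 = a * Real.sin α + b * Real.sin β := by
  refine ⟨-turn β x / Real.sin (β - α), turn α x / Real.sin (β - α),
    div_nonneg (by linarith) h.le, div_nonneg ha h.le, ?_, ?_⟩
  · have := planar_expansion_two α β x
    field_simp; linarith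
  · have := planar_expansion_three α β x
    field_simp; linarith

/-- A nonnegative multiple of a ray is detected by the sign of one neighbouring `turn`. -/
lemma exists_ray_coeff {α β : ℝ} (h : 0 < Real.sin (β - α)) {x : E4} (ha : turn α x = 0)
    (hb : turn β x ≤ 0) : ∃ a : ℝ, 0 ≤ a ∧ x 2 = a * Real.cos α ∧ x 3 = a * Real.sin α := by
  refine ⟨-turn β x / Real.sin (β - α), div_nonneg (by linarith) h.le, ?_, ?_⟩
  · have := planar_expansion_two α β x
    rw [ha] at this; field_simp; linarith
  · have := planar_expansion_three α β x
    rw [ha] at this; field_simp; linarith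

lemma exists_ray_coeff' {α β : ℝ} (h : 0 < Real.sin (β - α)) {x : E4} (ha : 0 ≤ turn α x)
    (hb : turn β x = 0) : ∃ b : ℝ, 0 ≤ b ∧ x 2 = b * Real.cos β ∧ x 3 = b * Real.sin β := by
  refine ⟨turn α x / Real.sin (β - α), div_nonneg ha h.le, ?_, ?_⟩
  · have := planar_expansion_two α β x
    rw [hb] at this; field_simp; linarith
  · have := planar_expansion_three α β x
    rw [hb] at this; field_simp; linarith

/-! ### The tile -/

/-- The cone over the tile: it is the union of a sector of width `π / 6` starting at the angle `τ`,
over the complement of the first quadrant, and of the same sector turned by `s`, over the first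
quadrant. -/
def tileCone (τ s : ℝ) : Set E4 :=
  {x | ((x 0 ≤ 0 ∨ x 1 ≤ 0) ∧ 0 ≤ turn τ x ∧ turn (τ + Real.pi / 6) x ≤ 0) ∨
    ((0 ≤ x 0 ∧ 0 ≤ x 1) ∧ 0 ≤ turn (τ + s) x ∧ turn (τ + s + Real.pi / 6) x ≤ 0)}

/-- The cone over the interior of the tile. -/
def openTileCone (τ s : ℝ) : Set E4 :=
  {x | ((x 0 ≤ 0 ∨ x 1 ≤ 0) → 0 < turn τ x ∧ turn (τ + Real.pi / 6) x < 0) ∧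
    ((0 ≤ x 0 ∧ 0 ≤ x 1) → 0 < turn (τ + s) x ∧ turn (τ + s + Real.pi / 6) x < 0)}

/-- The tile with base angle `τ` and shift `s`. -/
def tile (τ s : ℝ) : Set S3 := {x | (x : E4) ∈ tileCone τ s}

/-- The explicit description of the interior of the tile. -/
def openTile (τ s : ℝ) : Set S3 := {x | (x : E4) ∈ openTileCone τ s}

lemma openTileCone_subset (τ s : ℝ) : openTileCone τ s ⊆ tileCone τ s := by
  rintro x ⟨h1, h2⟩
  by_cases h : x 0 ≤ 0 ∨ x 1 ≤ 0
  · exact Or.inl ⟨h, (h1 h).1.le, (h1 h).2.le⟩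
  · push Not at h
    have := h2 ⟨h.1.le, h.2.le⟩
    exact Or.inr ⟨⟨h.1.le, h.2.le⟩, this.1.le, this.2.le⟩

lemma smul_mem_tileCone {τ s r : ℝ} (hr : 0 < r) {x : E4} :
    r • x ∈ tileCone τ s ↔ x ∈ tileCone τ s := by
  simp only [tileCone, mem_ofPred_eq, turn_smul, PiLp.smul_apply, smul_eq_mul]
  have hn : ∀ y : ℝ, r * y ≤ 0 ↔ y ≤ 0 := fun y => by
    rw [← not_lt, mul_pos_iff_of_pos_left hr, not_lt]
  simp only [mul_nonneg_iff_of_pos_left hr, hn]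

lemma smul_mem_openTileCone {τ s r : ℝ} (hr : 0 < r) {x : E4} :
    r • x ∈ openTileCone τ s ↔ x ∈ openTileCone τ s := by
  simp only [openTileCone, mem_ofPred_eq, turn_smul, PiLp.smul_apply, smul_eq_mul]
  have hn : ∀ y : ℝ, r * y ≤ 0 ↔ y ≤ 0 := fun y => by
    rw [← not_lt, mul_pos_iff_of_pos_left hr, not_lt]
  have hneg : ∀ y : ℝ, r * y < 0 ↔ y < 0 := fun y => by
    rw [← not_le, mul_nonneg_iff_of_pos_left hr, not_le]
  simp only [mul_nonneg_iff_of_pos_left hr, mul_pos_iff_of_pos_left hr, hneg, hn]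

/-! ### Interior, closure and frontier of the tile. -/

lemma isClosed_tile (τ s : ℝ) : IsClosed (tile τ s) := by
  have hc : ∀ γ, Continuous fun x : S3 => turn γ (x : E4) := fun γ =>
    (continuous_turn γ).comp continuous_subtype_val
  have h0 : Continuous fun x : S3 => (x : E4) 0 := by fun_prop
  have h1 : Continuous fun x : S3 => (x : E4) 1 := by fun_prop
  have key : ∀ f g : S3 → ℝ, Continuous f → Continuous g → IsClosed {x | f x ≤ g x} :=
    fun f g hf hg => isClosed_le hf hg
  change IsClosed (({x : S3 | (x : E4) 0 ≤ 0} ∪ {x : S3 | (x : E4) 1 ≤ 0}) ∩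
    ({x : S3 | 0 ≤ turn τ x} ∩ {x : S3 | turn (τ + Real.pi / 6) x ≤ 0}) ∪
    ({x : S3 | 0 ≤ (x : E4) 0} ∩ {x : S3 | 0 ≤ (x : E4) 1}) ∩
    ({x : S3 | 0 ≤ turn (τ + s) x} ∩ {x : S3 | turn (τ + s + Real.pi / 6) x ≤ 0}))
  exact (((key _ _ h0 continuous_const).union (key _ _ h1 continuous_const)).inter
    ((key _ _ continuous_const (hc _)).inter (key _ _ (hc _) continuous_const))).union
    (((key _ _ continuous_const h0).inter (key _ _ continuous_const h1)).inter
    ((key _ _ continuous_const (hc _)).inter (key _ _ (hc _) continuous_const)))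

/-- Read as "not the premise, or the conclusion", each implication in `openTileCone` is a
disjunction of strict inequalities, because its premise is a closed condition. Over the walls both
premises hold, so an interior point there must lie in both open sectors. -/
lemma isOpen_openTile (τ s : ℝ) : IsOpen (openTile τ s) := by
  have hc : ∀ γ, Continuous fun x : S3 => turn γ (x : E4) := fun γ =>
    (continuous_turn γ).comp continuous_subtype_val
  have h0 : Continuous fun x : S3 => (x : E4) 0 := by fun_prop
  have h1 : Continuous fun x : S3 => (x : E4) 1 := by fun_prop
  have : openTile τ s = {x : S3 |
      ((0 < (x : E4) 0 ∧ 0 < (x : E4) 1) ∨ (0 < turn τ x ∧ turn (τ + Real.pi / 6) x < 0)) ∧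
      (((x : E4) 0 < 0 ∨ (x : E4) 1 < 0) ∨
        (0 < turn (τ + s) x ∧ turn (τ + s + Real.pi / 6) x < 0))} := by
    ext x
    simp only [openTile, openTileCone, mem_ofPred_eq, imp_iff_not_or, not_or, not_and_or, not_le]
  rw [this]
  have key : ∀ f g : S3 → ℝ, Continuous f → Continuous g → IsOpen {x | f x < g x} :=
    fun f g hf hg => isOpen_lt hf hg
  refine IsOpen.inter (IsOpen.union (IsOpen.inter ?_ ?_) (IsOpen.inter ?_ ?_))
    (IsOpen.union (IsOpen.union ?_ ?_) (IsOpen.inter ?_ ?_)) <;>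
  exact key _ _ (by first | exact hc _ | exact h0 | exact h1 | exact continuous_const)
    (by first | exact hc _ | exact h0 | exact h1 | exact continuous_const)

/-- A point of `S³` with small perturbations in a cone `C` is a limit of points of `C ∩ S³`. -/
lemma mem_closure_of_eventually {C : Set E4} (hC : ∀ r : ℝ, 0 < r → ∀ x, x ∈ C → r • x ∈ C)
    {x : S3} (w : E4) (h : ∀ᶠ ε : ℝ in 𝓝[>] 0, (x : E4) + ε • w ∈ C) :
    x ∈ closure {y : S3 | (y : E4) ∈ C} := by
  have hcont : Tendsto (fun ε : ℝ => (x : E4) + ε • w) (𝓝[>] 0) (𝓝 (x : E4)) := by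
    have : Tendsto (fun ε : ℝ => (x : E4) + ε • w) (𝓝 0) (𝓝 ((x : E4) + (0 : ℝ) • w)) :=
      Continuous.tendsto (by fun_prop) 0
    simpa using this.mono_left nhdsWithin_le_nhds
  have hnorm : Tendsto (fun ε : ℝ => ‖(x : E4) + ε • w‖⁻¹ • ((x : E4) + ε • w))
      (𝓝[>] 0) (𝓝 (x : E4)) := by
    have h1 := (hcont.norm.inv₀ (by simp)).smul hcont
    simpa using h1
  have hne : ∀ᶠ ε : ℝ in 𝓝[>] 0, 0 < ‖(x : E4) + ε • w‖ :=
    hcont.norm.eventually (lt_mem_nhds (by simp))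
  rw [mem_closure_iff_nhds]
  intro U hU
  rw [nhds_subtype_eq_comap, mem_comap] at hU
  obtain ⟨V, hV, hVU⟩ := hU
  obtain ⟨ε, h1, h2, h3⟩ := (h.and (hne.and (hnorm.eventually hV))).exists
  have hmem : ‖(x : E4) + ε • w‖⁻¹ • ((x : E4) + ε • w) ∈ Metric.sphere (0 : E4) 1 := by
    rw [mem_sphere_zero_iff_norm, norm_smul, norm_inv, norm_norm, inv_mul_cancel₀ h2.ne']
  exact ⟨⟨_, hmem⟩, hVU h3, hC _ (inv_pos.2 h2) _ h1⟩

lemma turn_vec (γ a b c d : ℝ) :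
    turn γ (vec a b c d) = Real.cos γ * d - Real.sin γ * c := rfl

lemma turn_vec_normal (γ a b r : ℝ) :
    turn γ (vec a b (-(r * Real.sin γ)) (r * Real.cos γ)) = r := by
  have := Real.sin_sq_add_cos_sq γ
  rw [turn_vec]; linear_combination r * this

lemma turn_vec_ray (γ a b β : ℝ) :
    turn γ (vec a b (Real.cos β) (Real.sin β)) = Real.sin (β - γ) := by
  rw [turn_vec, Real.sin_sub]; ring

/-- If `x` fails the strict sector condition of a region it lies over, move it strictly inside that
region and, at the same time, outwards across the violated side. The other region then has no say,
and the moved point is outside the tile. -/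
lemma not_mem_interior_tile {τ s : ℝ} {x : S3} (hx : x ∉ openTile τ s) :
    x ∉ interior (tile τ s) := by
  rw [← mem_compl_iff, ← closure_compl]
  have hC : ∀ r : ℝ, 0 < r → ∀ y, y ∈ (tileCone τ s)ᶜ → r • y ∈ (tileCone τ s)ᶜ :=
    fun r hr y hy h => hy ((smul_mem_tileCone hr).1 h)
  have key : ∃ w : E4, ∀ ε : ℝ, 0 < ε → (x : E4) + ε • w ∈ (tileCone τ s)ᶜ := by
    by_cases hP : ((x : E4) 0 ≤ 0 ∨ (x : E4) 1 ≤ 0) ∧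
        ¬ (0 < turn τ x ∧ turn (τ + Real.pi / 6) x < 0)
    · obtain ⟨hP, h⟩ := hP
      have hQ : ∀ a b ε : ℝ, 0 < ε →
          ¬ (0 ≤ ((x : E4) + ε • vec (-1) (-1) a b) 0 ∧
            0 ≤ ((x : E4) + ε • vec (-1) (-1) a b) 1) := by
        rintro a b ε hε ⟨h0, h1⟩
        simp only [PiLp.add_apply, PiLp.smul_apply, vec_zero, vec_one, smul_eq_mul] at h0 h1
        rcases hP with h | h <;> linarith
      rw [not_and_or, not_lt, not_lt] at h
      rcases h with h | h
      -- The first two entries push off the quadrant; the last two make `turn τ` of the displacement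
      -- equal to `-1`.
      · refine ⟨vec (-1) (-1) (-(-1 * Real.sin τ)) (-1 * Real.cos τ), fun ε hε hm => ?_⟩
        rcases hm with ⟨-, hm, -⟩ | ⟨hm, -⟩
        · rw [turn_add, turn_smul, turn_vec_normal] at hm; linarith
        · exact hQ _ _ ε hε hm
      · refine ⟨vec (-1) (-1) (-(1 * Real.sin (τ + Real.pi / 6))) (1 * Real.cos (τ + Real.pi / 6)),
          fun ε hε hm => ?_⟩
        rcases hm with ⟨-, -, hm⟩ | ⟨hm, -⟩
        · rw [turn_add, turn_smul, turn_vec_normal] at hm; linarith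
        · exact hQ _ _ ε hε hm
    · have hQ' : (0 ≤ (x : E4) 0 ∧ 0 ≤ (x : E4) 1) ∧
          ¬ (0 < turn (τ + s) x ∧ turn (τ + s + Real.pi / 6) x < 0) := by
        by_contra h
        exact hx ⟨fun h1 => by_contra fun h2 => hP ⟨h1, h2⟩,
          fun h1 => by_contra fun h2 => h ⟨h1, h2⟩⟩
      obtain ⟨hQ, h⟩ := hQ'
      have hP : ∀ a b ε : ℝ, 0 < ε →
          ¬ (((x : E4) + ε • vec 1 1 a b) 0 ≤ 0 ∨ ((x : E4) + ε • vec 1 1 a b) 1 ≤ 0) := by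
        rintro a b ε hε (h0 | h0) <;>
        simp only [PiLp.add_apply, PiLp.smul_apply, vec_zero, vec_one, smul_eq_mul] at h0 <;>
        linarith [hQ.1, hQ.2]
      rw [not_and_or, not_lt, not_lt] at h
      rcases h with h | h
      · refine ⟨vec 1 1 (-(-1 * Real.sin (τ + s))) (-1 * Real.cos (τ + s)), fun ε hε hm => ?_⟩
        rcases hm with ⟨hm, -⟩ | ⟨-, hm, -⟩
        · exact hP _ _ ε hε hm
        · rw [turn_add, turn_smul, turn_vec_normal] at hm; linarith
      · refine ⟨vec 1 1 (-(1 * Real.sin (τ + s + Real.pi / 6)))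
          (1 * Real.cos (τ + s + Real.pi / 6)), fun ε hε hm => ?_⟩
        rcases hm with ⟨hm, -⟩ | ⟨-, -, hm⟩
        · exact hP _ _ ε hε hm
        · rw [turn_add, turn_smul, turn_vec_normal] at hm; linarith
  obtain ⟨w, hw⟩ := key
  exact mem_closure_of_eventually hC w (eventually_nhdsWithin_of_forall hw)

lemma interior_tile (τ s : ℝ) : interior (tile τ s) = openTile τ s := by
  apply Subset.antisymm
  · intro x hx
    by_contra h
    exact not_mem_interior_tile h hx
  · exact interior_maximal (fun x hx => openTileCone_subset τ s hx) (isOpen_openTile τ s)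

lemma frontier_tile (τ s : ℝ) : frontier (tile τ s) = tile τ s \ openTile τ s := by
  rw [(isClosed_tile τ s).frontier_eq, interior_tile]

lemma closure_interior_tile (τ s : ℝ) : closure (interior (tile τ s)) = tile τ s := by
  apply Subset.antisymm
  · exact closure_minimal interior_subset (isClosed_tile τ s)
  · intro x hx
    rw [interior_tile]
    have hC : ∀ r : ℝ, 0 < r → ∀ y, y ∈ openTileCone τ s → r • y ∈ openTileCone τ s :=
      fun r hr y hy => (smul_mem_openTileCone hr).2 hy
    have hpi := Real.pi_pos
    have h12 : 0 < Real.sin (Real.pi / 12) :=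
      Real.sin_pos_of_pos_of_lt_pi (by linarith) (by linarith)
    rcases hx with ⟨hP, h1, h2⟩ | ⟨hQ, h1, h2⟩
    -- Push away from the walls and towards the bisector of the sector, at `τ + π / 12`.
    · refine mem_closure_of_eventually hC (vec (-1) (-1) (Real.cos (τ + Real.pi / 12))
        (Real.sin (τ + Real.pi / 12))) (eventually_nhdsWithin_of_forall fun ε hε => ?_)
      have hε : 0 < ε := hε
      constructor
      · intro _
        rw [turn_add, turn_smul, turn_add, turn_smul, turn_vec_ray, turn_vec_ray,
          show τ + Real.pi / 12 - τ = Real.pi / 12 by ring,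
          show τ + Real.pi / 12 - (τ + Real.pi / 6) = -(Real.pi / 12) by ring, Real.sin_neg]
        constructor <;> nlinarith [mul_pos hε h12]
      · rintro ⟨h0, h1⟩
        simp only [PiLp.add_apply, PiLp.smul_apply, vec_zero, vec_one, smul_eq_mul] at h0 h1
        rcases hP with h | h <;> linarith
    · refine mem_closure_of_eventually hC (vec 1 1 (Real.cos (τ + s + Real.pi / 12))
        (Real.sin (τ + s + Real.pi / 12))) (eventually_nhdsWithin_of_forall fun ε hε => ?_)
      have hε : 0 < ε := hε
      constructor
      · rintro (h0 | h0) <;>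
        simp only [PiLp.add_apply, PiLp.smul_apply, vec_zero, vec_one, smul_eq_mul] at h0 <;>
        linarith [hQ.1, hQ.2]
      · intro _
        rw [turn_add, turn_smul, turn_add, turn_smul, turn_vec_ray, turn_vec_ray,
          show τ + s + Real.pi / 12 - (τ + s) = Real.pi / 12 by ring,
          show τ + s + Real.pi / 12 - (τ + s + Real.pi / 6) = -(Real.pi / 12) by ring,
          Real.sin_neg]
        constructor <;> nlinarith [mul_pos hε h12]

/-! ### The boundary surface of the tile -/

/-- The triangles of the boundary surface. -/
def faces : Finset (Finset (Fin 7)) :=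
  -- First row: the lower side, namely the outer sector face cut in two by the edge `{2, 3}`, the
  -- two lower walls, and the inner sector face. Second row: the same for the upper side, in
  -- corresponding order.
  {{1, 2, 3}, {0, 2, 3}, {0, 3, 4}, {1, 3, 4}, {0, 1, 4},
    {1, 2, 5}, {0, 2, 5}, {0, 5, 6}, {1, 5, 6}, {0, 1, 6}}

/-- The vertices of the tile, as vectors. -/
noncomputable def vertexVec (τ s : ℝ) : Fin 7 → E4 :=
  -- The third axis vertex is a rational unit vector in the open third quadrant: it cuts the outer
  -- three quarters of the axis into two arcs shorter than `π`.
  ![vec 1 0 0 0, vec 0 1 0 0, vec (-(3 / 5)) (-(4 / 5)) 0 0, ray τ, ray (τ + s),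
    ray (τ + Real.pi / 6), ray (τ + s + Real.pi / 6)]

lemma norm_ray (γ : ℝ) : ‖ray γ‖ = 1 := by
  apply norm_eq_one_of_coord
  simp [ray, Real.cos_sq_add_sin_sq]

lemma norm_vertexVec (τ s : ℝ) (v : Fin 7) : ‖vertexVec τ s v‖ = 1 := by
  fin_cases v
  · exact norm_eq_one_of_coord (by simp [vertexVec])
  · exact norm_eq_one_of_coord (by simp [vertexVec])
  · exact norm_eq_one_of_coord (by simp [vertexVec]; norm_num)
  all_goals exact norm_ray _

/-- The vertices of the tile. -/
noncomputable def vertex (τ s : ℝ) (v : Fin 7) : S3 :=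
  ⟨vertexVec τ s v, by rw [mem_sphere_zero_iff_norm, norm_vertexVec]⟩

/-- Linear combinations of the vertices. -/
noncomputable def combo (τ s : ℝ) (c : Fin 7 → ℝ) : E4 := ∑ v, c v • vertexVec τ s v

lemma combo_zero (τ s : ℝ) (c : Fin 7 → ℝ) : combo τ s c 0 = c 0 - 3 / 5 * c 2 := by
  simp [combo, Fin.sum_univ_seven, vertexVec, ray]; ring

lemma combo_one (τ s : ℝ) (c : Fin 7 → ℝ) : combo τ s c 1 = c 1 - 4 / 5 * c 2 := by
  simp [combo, Fin.sum_univ_seven, vertexVec, ray]; ring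

lemma combo_two (τ s : ℝ) (c : Fin 7 → ℝ) : combo τ s c 2 =
    c 3 * Real.cos τ + c 4 * Real.cos (τ + s) + c 5 * Real.cos (τ + Real.pi / 6) +
      c 6 * Real.cos (τ + s + Real.pi / 6) := by
  simp [combo, Fin.sum_univ_seven, vertexVec, ray]

lemma combo_three (τ s : ℝ) (c : Fin 7 → ℝ) : combo τ s c 3 =
    c 3 * Real.sin τ + c 4 * Real.sin (τ + s) + c 5 * Real.sin (τ + Real.pi / 6) +
      c 6 * Real.sin (τ + s + Real.pi / 6) := by
  simp [combo, Fin.sum_univ_seven, vertexVec, ray]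

lemma turn_combo (τ s γ : ℝ) (c : Fin 7 → ℝ) : turn γ (combo τ s c) =
    c 3 * Real.sin (τ - γ) + c 4 * Real.sin (τ + s - γ) + c 5 * Real.sin (τ + Real.pi / 6 - γ) +
      c 6 * Real.sin (τ + s + Real.pi / 6 - γ) := by
  simp only [turn, combo_two, combo_three, Real.sin_sub]; ring

lemma sum_smul_eq_combo (τ s : ℝ) (f : Finset (Fin 7)) (c : Fin 7 → ℝ) :
    ∑ v ∈ f, c v • (vertex τ s v : E4) = combo τ s fun v => if v ∈ f then c v else 0 := by
  simp [combo, vertex, ite_smul, Finset.sum_ite_mem]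

lemma mem_sphericalSimplex_iff {τ s : ℝ} {f : Finset (Fin 7)} {x : S3} :
    x ∈ sphericalSimplex (vertex τ s) f ↔
      ∃ c : Fin 7 → ℝ, (∀ v, 0 ≤ c v) ∧ (∀ v, v ∉ f → c v = 0) ∧ (x : E4) = combo τ s c := by
  constructor
  · rintro ⟨c, hc, hx⟩
    rw [sum_smul_eq_combo] at hx
    refine ⟨_, fun v => ?_, fun v hv => if_neg hv, hx⟩
    by_cases hv : v ∈ f
    · rw [if_pos hv]; exact hc v hv
    · rw [if_neg hv]
  · rintro ⟨c, hc, h0, hx⟩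
    refine ⟨c, fun v _ => hc v, ?_⟩
    rw [sum_smul_eq_combo, hx]
    congr 1; funext v
    by_cases hv : v ∈ f
    · rw [if_pos hv]
    · rw [if_neg hv, h0 v hv]

/-! ### Uniqueness of face coordinates, embeddedness and nondegeneracy. -/

/-- The two planes separate. In the axis plane the only relation among the vertices 0, 1, 2 has all
coefficients of one sign, so nonnegative coordinates with a zero among them are unique. In the dual
plane the cones on the vertices 3, 4 and on 5, 6 meet only at the origin, as `s < π / 6`. -/
lemma combo_unique {τ s : ℝ} (hs : 0 < s) (hs' : s < Real.pi / 6) {c d : Fin 7 → ℝ}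
    (hc : ∀ v, 0 ≤ c v) (hd : ∀ v, 0 ≤ d v)
    (hc1 : c 0 = 0 ∨ c 1 = 0 ∨ c 2 = 0) (hd1 : d 0 = 0 ∨ d 1 = 0 ∨ d 2 = 0)
    (hc2 : (c 3 = 0 ∧ c 4 = 0) ∨ (c 5 = 0 ∧ c 6 = 0))
    (hd2 : (d 3 = 0 ∧ d 4 = 0) ∨ (d 5 = 0 ∧ d 6 = 0))
    (h : combo τ s c = combo τ s d) : c = d := by
  have hpi := Real.pi_pos
  have S1 : 0 < Real.sin s := Real.sin_pos_of_pos_of_lt_pi hs (by linarith)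
  have S2 : 0 < Real.sin (Real.pi / 6) :=
    Real.sin_pos_of_pos_of_lt_pi (by linarith) (by linarith)
  have S3 : 0 < Real.sin (Real.pi / 6 - s) :=
    Real.sin_pos_of_pos_of_lt_pi (by linarith) (by linarith)
  have e0 := congrArg (fun x : E4 => x 0) h
  have e1 := congrArg (fun x : E4 => x 1) h
  simp only [combo_zero, combo_one] at e0 e1
  have h2 : c 2 = d 2 := by
    -- If the coefficients at 2 differ, the larger family exceeds the smaller at 0 and 1 too, so all
    -- three of its entries are positive.
    rcases lt_trichotomy (c 2) (d 2) with hlt | heq | hgt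
    · have := hc 0; have := hc 1; have := hc 2
      rcases hd1 with h | h | h <;> linarith
    · exact heq
    · have := hd 0; have := hd 1; have := hd 2
      rcases hc1 with h | h | h <;> linarith
  have h0 : c 0 = d 0 := by linarith
  have h1 : c 1 = d 1 := by linarith
  have t : ∀ γ, turn γ (combo τ s c) = turn γ (combo τ s d) := fun γ => by rw [h]
  simp only [turn_combo] at t
  have t0 := t τ
  have t1 := t (τ + s)
  have t2 := t (τ + Real.pi / 6)
  have t3 := t (τ + s + Real.pi / 6)
  have a1 : τ + s - (τ + Real.pi / 6) = -(Real.pi / 6 - s) := by ring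
  have a2 : τ - (τ + s) = -s := by ring
  have a3 : τ + Real.pi / 6 - (τ + s) = Real.pi / 6 - s := by ring
  have a4 : τ + s + Real.pi / 6 - (τ + s) = Real.pi / 6 := by ring
  have a5 : τ + Real.pi / 6 - (τ + s + Real.pi / 6) = -s := by ring
  have a6 : τ + s + Real.pi / 6 - (τ + Real.pi / 6) = s := by ring
  simp only [a1, a2, a3, a4, a5, a6, sub_self, Real.sin_zero, add_sub_cancel_left, mul_zero,
    add_zero, zero_add, Real.sin_neg] at t0 t1 t2 t3
  -- The line through the ray at `τ + s` separates the two wall sectors: its `turn` gives opposite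
  -- signs to the two sides of the equation, so every term vanishes.
  have mixed : ∀ {p q r u : ℝ}, 0 ≤ p → 0 ≤ q → 0 ≤ r → 0 ≤ u →
      p * -Real.sin s = r * Real.sin (Real.pi / 6 - s) + u * Real.sin (Real.pi / 6) →
      p = 0 ∧ r = 0 ∧ u = 0 := by
    intro p q r u hp hq hr hu he
    have b1 := mul_nonneg hp S1.le
    have b2 := mul_nonneg hr S3.le
    have b3 := mul_nonneg hu S2.le
    refine ⟨?_, ?_, ?_⟩
    · exact (mul_eq_zero.1 (by linarith : p * Real.sin s = 0)).resolve_right S1.ne'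
    · exact (mul_eq_zero.1 (by linarith : r * Real.sin (Real.pi / 6 - s) = 0)).resolve_right S3.ne'
    · exact (mul_eq_zero.1 (by linarith : u * Real.sin (Real.pi / 6) = 0)).resolve_right S2.ne'
  have hz : c 3 = d 3 ∧ c 4 = d 4 ∧ c 5 = d 5 ∧ c 6 = d 6 := by
    rcases hc2 with ⟨x3, x4⟩ | ⟨x3, x4⟩ <;> rcases hd2 with ⟨y3, y4⟩ | ⟨y3, y4⟩ <;>
      simp only [x3, x4, y3, y4, zero_mul, zero_add, add_zero] at t0 t1 t2 t3 ⊢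
    · refine ⟨trivial, trivial, ?_, mul_right_cancel₀ S1.ne' t2⟩
      have := mul_right_cancel₀ S1.ne' t2
      rw [this] at t1
      exact mul_right_cancel₀ S3.ne' (by linarith)
    · obtain ⟨p, q, r⟩ := mixed (hd 3) (hd 4) (hc 5) (hc 6) t1.symm
      rw [q, r] at t0
      simp only [zero_mul, zero_add] at t0
      have := (mul_eq_zero.1 t0.symm).resolve_right S1.ne'
      simp [p, q, r, this]
    · obtain ⟨p, q, r⟩ := mixed (hc 3) (hc 4) (hd 5) (hd 6) t1
      rw [q, r] at t0
      simp only [zero_mul, zero_add] at t0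
      have := (mul_eq_zero.1 t0).resolve_right S1.ne'
      simp [p, q, r, this]
    · refine ⟨mul_right_cancel₀ (neg_ne_zero.2 S1.ne') t1, mul_right_cancel₀ S1.ne' t0,
        trivial, trivial⟩
  funext v
  fin_cases v
  · exact h0
  · exact h1
  · exact h2
  · exact hz.1
  · exact hz.2.1
  · exact hz.2.2.1
  · exact hz.2.2.2

set_option maxRecDepth 20000 in
lemma faces_support : ∀ f ∈ faces, (0 ∉ f ∨ 1 ∉ f ∨ 2 ∉ f) ∧
    ((3 ∉ f ∧ 4 ∉ f) ∨ (5 ∉ f ∧ 6 ∉ f)) := by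
  decide

lemma combo_unique_of_faces {τ s : ℝ} (hs : 0 < s) (hs' : s < Real.pi / 6) {c d : Fin 7 → ℝ}
    {f g : Finset (Fin 7)} (hf : f ∈ faces) (hg : g ∈ faces)
    (hc : ∀ v, 0 ≤ c v) (hd : ∀ v, 0 ≤ d v)
    (hcf : ∀ v, v ∉ f → c v = 0) (hdg : ∀ v, v ∉ g → d v = 0)
    (h : combo τ s c = combo τ s d) : c = d := by
  obtain ⟨f1, f2⟩ := faces_support f hf
  obtain ⟨g1, g2⟩ := faces_support g hg
  exact combo_unique hs hs' hc hd (f1.imp (hcf _) (Or.imp (hcf _) (hcf _)))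
    (g1.imp (hdg _) (Or.imp (hdg _) (hdg _))) (f2.imp (And.imp (hcf _) (hcf _))
    (And.imp (hcf _) (hcf _))) (g2.imp (And.imp (hdg _) (hdg _)) (And.imp (hdg _) (hdg _))) h

/-- A common point of two faces has the same coordinates in both, so its coordinates are supported
on the common vertices. -/
lemma simplex_inter {τ s : ℝ} (hs : 0 < s) (hs' : s < Real.pi / 6) {f g : Finset (Fin 7)}
    (hf : f ∈ faces) (hg : g ∈ faces) :
    sphericalSimplex (vertex τ s) f ∩ sphericalSimplex (vertex τ s) g =
      sphericalSimplex (vertex τ s) (f ∩ g) := by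
  ext x
  simp only [mem_inter_iff, mem_sphericalSimplex_iff, Finset.mem_inter, not_and_or]
  constructor
  · rintro ⟨⟨c, hc, hcf, hx⟩, ⟨d, hd, hdg, hx'⟩⟩
    have := combo_unique_of_faces hs hs' hf hg hc hd hcf hdg (hx.symm.trans hx')
    subst this
    exact ⟨c, hc, fun v hv => hv.elim (hcf v) (hdg v), hx⟩
  · rintro ⟨c, hc, h0, hx⟩
    exact ⟨⟨c, hc, fun v hv => h0 v (Or.inl hv), hx⟩, ⟨c, hc, fun v hv => h0 v (Or.inr hv), hx⟩⟩

lemma linearIndependent_face {τ s : ℝ} (hs : 0 < s) (hs' : s < Real.pi / 6) {f : Finset (Fin 7)}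
    (hf : f ∈ faces) : LinearIndependent ℝ (fun v : f => (vertex τ s v : E4)) := by
  rw [Fintype.linearIndependent_iff]
  intro g hg
  set c : Fin 7 → ℝ := fun v => if h : v ∈ f then g ⟨v, h⟩ else 0 with hcdef
  have hcf : ∀ v, v ∉ f → c v = 0 := fun v hv => dif_neg hv
  have hsum : combo τ s c = 0 := by
    have h1 : ∑ v ∈ f, c v • (vertex τ s v : E4) = 0 := by
      rw [← Finset.sum_coe_sort]
      refine Eq.trans ?_ hg
      refine Finset.sum_congr rfl fun v _ => ?_
      simp [hcdef]
    rw [sum_smul_eq_combo] at h1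
    rw [← h1]
    congr 1; funext v
    by_cases hv : v ∈ f
    · rw [if_pos hv]
    · rw [if_neg hv, hcf v hv]
  -- Positive and negative parts of a linear relation are two nonnegative representations of one
  -- vector on the same face; uniqueness makes them equal, and the relation is trivial.
  have hsplit : combo τ s (fun v => max (c v) 0) = combo τ s (fun v => max (-c v) 0) := by
    rw [← sub_eq_zero, ← hsum]
    simp only [combo, ← Finset.sum_sub_distrib, ← sub_smul]
    refine Finset.sum_congr rfl fun v _ => ?_
    rw [max_zero_sub_max_neg_zero_eq_self]
  have heq := combo_unique_of_faces hs hs' hf hf (fun v => le_max_right _ _)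
    (fun v => le_max_right _ _) (fun v hv => by simp [hcf v hv])
    (fun v hv => by simp [hcf v hv]) hsplit
  intro v
  have h1 := congrFun heq v
  have h2 := max_zero_sub_max_neg_zero_eq_self (c v)
  rw [h1, sub_self] at h2
  have : c v = g v := by simp [hcdef]
  rw [← this, ← h2]

/-! ### The frontier of the tile is the triangulated surface. -/

lemma turn_combo_base (τ s : ℝ) (c : Fin 7 → ℝ) : turn τ (combo τ s c) =
    c 4 * Real.sin s + c 5 * Real.sin (Real.pi / 6) + c 6 * Real.sin (s + Real.pi / 6) := by
  rw [turn_combo]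
  simp [add_sub_cancel_left, add_assoc]

lemma turn_combo_base_top (τ s : ℝ) (c : Fin 7 → ℝ) :
    turn (τ + Real.pi / 6) (combo τ s c) = -(c 3 * Real.sin (Real.pi / 6)) -
      c 4 * Real.sin (Real.pi / 6 - s) + c 6 * Real.sin s := by
  rw [turn_combo, show τ - (τ + Real.pi / 6) = -(Real.pi / 6) by ring,
    show τ + s - (τ + Real.pi / 6) = -(Real.pi / 6 - s) by ring, sub_self,
    show τ + s + Real.pi / 6 - (τ + Real.pi / 6) = s by ring, Real.sin_neg, Real.sin_neg,
    Real.sin_zero]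
  ring

lemma turn_combo_shift (τ s : ℝ) (c : Fin 7 → ℝ) :
    turn (τ + s) (combo τ s c) = -(c 3 * Real.sin s) +
      c 5 * Real.sin (Real.pi / 6 - s) + c 6 * Real.sin (Real.pi / 6) := by
  rw [turn_combo, show τ - (τ + s) = -s by ring, sub_self,
    show τ + Real.pi / 6 - (τ + s) = Real.pi / 6 - s by ring,
    show τ + s + Real.pi / 6 - (τ + s) = Real.pi / 6 by ring, Real.sin_neg, Real.sin_zero]
  ring

lemma turn_combo_shift_top (τ s : ℝ) (c : Fin 7 → ℝ) :
    turn (τ + s + Real.pi / 6) (combo τ s c) = -(c 3 * Real.sin (s + Real.pi / 6)) -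
      c 4 * Real.sin (Real.pi / 6) - c 5 * Real.sin s := by
  rw [turn_combo, show τ - (τ + s + Real.pi / 6) = -(s + Real.pi / 6) by ring, sub_self,
    show τ + s - (τ + s + Real.pi / 6) = -(Real.pi / 6) by ring,
    show τ + Real.pi / 6 - (τ + s + Real.pi / 6) = -s by ring, Real.sin_neg, Real.sin_neg,
    Real.sin_neg, Real.sin_zero]
  ring

lemma sin_pos_aux {s : ℝ} (hs : 0 < s) (hs' : s < Real.pi / 6) :
    0 < Real.sin s ∧ 0 < Real.sin (Real.pi / 6) ∧ 0 < Real.sin (Real.pi / 6 - s) ∧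
      0 < Real.sin (s + Real.pi / 6) := by
  have hpi := Real.pi_pos
  refine ⟨?_, ?_, ?_, ?_⟩ <;> apply Real.sin_pos_of_pos_of_lt_pi <;> linarith

/-- On a sector face one side condition of its own region becomes an equality. A wall lies over the
boundary of the quadrant: its points satisfy the closed conditions of one region but not the strict
conditions of the other. -/
lemma surface_subset {τ s : ℝ} (hs : 0 < s) (hs' : s < Real.pi / 6) {f : Finset (Fin 7)}
    (hf : f ∈ faces) {x : S3} (hx : x ∈ sphericalSimplex (vertex τ s) f) :
    x ∈ tile τ s \ openTile τ s := by
  obtain ⟨S1, S2, S3, S4⟩ := sin_pos_aux hs hs'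
  obtain ⟨c, hc, h0, hx⟩ := mem_sphericalSimplex_iff.1 hx
  have p1 : ∀ v, 0 ≤ c v * Real.sin s := fun v => mul_nonneg (hc v) S1.le
  have p2 : ∀ v, 0 ≤ c v * Real.sin (Real.pi / 6) := fun v => mul_nonneg (hc v) S2.le
  have p3 : ∀ v, 0 ≤ c v * Real.sin (Real.pi / 6 - s) := fun v => mul_nonneg (hc v) S3.le
  change (x : E4) ∈ tileCone τ s ∧ (x : E4) ∉ openTileCone τ s
  rw [hx]
  simp only [tileCone, openTileCone, mem_ofPred_eq, combo_zero, combo_one, turn_combo_base,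
    turn_combo_base_top, turn_combo_shift, turn_combo_shift_top]
  have c0 := hc 0
  have c1 := hc 1
  have c2 := hc 2
  simp only [faces, Finset.mem_insert, Finset.mem_singleton] at hf
  rcases hf with rfl | rfl | rfl | rfl | rfl | rfl | rfl | rfl | rfl | rfl
  · have z0 := h0 0 (by decide)
    have z4 := h0 4 (by decide)
    have z5 := h0 5 (by decide)
    have z6 := h0 6 (by decide)
    simp only [z0, z4, z5, z6, zero_mul, add_zero, sub_zero]
    exact ⟨Or.inl ⟨Or.inl (by linarith), le_rfl, by linarith [p2 3]⟩,
      fun h => (h.1 (Or.inl (by linarith))).1.false⟩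
  · have z1 := h0 1 (by decide)
    have z4 := h0 4 (by decide)
    have z5 := h0 5 (by decide)
    have z6 := h0 6 (by decide)
    simp only [z1, z4, z5, z6, zero_mul, add_zero, sub_zero]
    exact ⟨Or.inl ⟨Or.inr (by linarith), le_rfl, by linarith [p2 3]⟩,
      fun h => (h.1 (Or.inr (by linarith))).1.false⟩
  · have z1 := h0 1 (by decide)
    have z2 := h0 2 (by decide)
    have z5 := h0 5 (by decide)
    have z6 := h0 6 (by decide)
    simp only [z1, z2, z5, z6, mul_zero, zero_mul, add_zero, sub_zero]
    exact ⟨Or.inl ⟨Or.inr le_rfl, p1 4, by linarith [p2 3, p3 4]⟩,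
      fun h => by linarith [(h.2 ⟨c0, le_rfl⟩).1, p1 3]⟩
  · have z0 := h0 0 (by decide)
    have z2 := h0 2 (by decide)
    have z5 := h0 5 (by decide)
    have z6 := h0 6 (by decide)
    simp only [z0, z2, z5, z6, mul_zero, zero_mul, add_zero, sub_zero]
    exact ⟨Or.inl ⟨Or.inl le_rfl, p1 4, by linarith [p2 3, p3 4]⟩,
      fun h => by linarith [(h.2 ⟨le_rfl, c1⟩).1, p1 3]⟩
  · have z2 := h0 2 (by decide)
    have z3 := h0 3 (by decide)
    have z5 := h0 5 (by decide)
    have z6 := h0 6 (by decide)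
    simp only [z2, z3, z5, z6, mul_zero, zero_mul, add_zero, sub_zero, neg_zero, zero_sub]
    exact ⟨Or.inr ⟨⟨c0, c1⟩, le_rfl, by linarith [p2 4]⟩,
      fun h => (h.2 ⟨c0, c1⟩).1.false⟩
  · have z0 := h0 0 (by decide)
    have z3 := h0 3 (by decide)
    have z4 := h0 4 (by decide)
    have z6 := h0 6 (by decide)
    simp only [z0, z3, z4, z6, zero_mul, zero_add, add_zero, sub_zero, neg_zero]
    exact ⟨Or.inl ⟨Or.inl (by linarith), p2 5, le_rfl⟩,
      fun h => (h.1 (Or.inl (by linarith))).2.false⟩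
  · have z1 := h0 1 (by decide)
    have z3 := h0 3 (by decide)
    have z4 := h0 4 (by decide)
    have z6 := h0 6 (by decide)
    simp only [z1, z3, z4, z6, zero_mul, zero_add, add_zero, sub_zero, neg_zero]
    exact ⟨Or.inl ⟨Or.inr (by linarith), p2 5, le_rfl⟩,
      fun h => (h.1 (Or.inr (by linarith))).2.false⟩
  · have z1 := h0 1 (by decide)
    have z2 := h0 2 (by decide)
    have z3 := h0 3 (by decide)
    have z4 := h0 4 (by decide)
    simp only [z1, z2, z3, z4, mul_zero, zero_mul, zero_add, sub_zero, neg_zero, zero_sub]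
    exact ⟨Or.inr ⟨⟨c0, le_rfl⟩, by linarith [p3 5, p2 6], by linarith [p1 5]⟩,
      fun h => by linarith [(h.1 (Or.inr le_rfl)).2, p1 6]⟩
  · have z0 := h0 0 (by decide)
    have z2 := h0 2 (by decide)
    have z3 := h0 3 (by decide)
    have z4 := h0 4 (by decide)
    simp only [z0, z2, z3, z4, mul_zero, zero_mul, zero_add, sub_zero, neg_zero, zero_sub]
    exact ⟨Or.inr ⟨⟨le_rfl, c1⟩, by linarith [p3 5, p2 6], by linarith [p1 5]⟩,
      fun h => by linarith [(h.1 (Or.inl le_rfl)).2, p1 6]⟩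
  · have z2 := h0 2 (by decide)
    have z3 := h0 3 (by decide)
    have z4 := h0 4 (by decide)
    have z5 := h0 5 (by decide)
    simp only [z2, z3, z4, z5, mul_zero, zero_mul, zero_add, add_zero, sub_zero, neg_zero]
    exact ⟨Or.inr ⟨⟨c0, c1⟩, p2 6, le_rfl⟩,
      fun h => (h.2 ⟨c0, c1⟩).2.false⟩

lemma mem_surface {τ s : ℝ} {x : S3} (c : Fin 7 → ℝ) {f : Finset (Fin 7)} (hf : f ∈ faces)
    (hc : ∀ v, 0 ≤ c v) (h0 : ∀ v, v ∈ f ∨ c v = 0) (hx : (x : E4) = combo τ s c) :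
    x ∈ ⋃ f ∈ faces, sphericalSimplex (vertex τ s) f :=
  mem_biUnion hf (mem_sphericalSimplex_iff.2 ⟨c, hc, fun v => (h0 v).resolve_left, hx⟩)

lemma nonneg_of_components {c : Fin 7 → ℝ} (h0 : 0 ≤ c 0) (h1 : 0 ≤ c 1) (h2 : 0 ≤ c 2)
    (h3 : 0 ≤ c 3) (h4 : 0 ≤ c 4) (h5 : 0 ≤ c 5) (h6 : 0 ≤ c 6) : ∀ v, 0 ≤ c v := by
  intro v; fin_cases v <;> assumption

lemma exists_outer_coeffs {p q : ℝ} (h : p ≤ 0 ∨ q ≤ 0) :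
    (∃ b c : ℝ, 0 ≤ b ∧ 0 ≤ c ∧ p = -(3 / 5 * c) ∧ q = b - 4 / 5 * c) ∨
    (∃ a c : ℝ, 0 ≤ a ∧ 0 ≤ c ∧ p = a - 3 / 5 * c ∧ q = -(4 / 5 * c)) := by
  -- The line `q = 4 / 3 * p` carries the axis vertex 2, whose ray divides the complement of the
  -- quadrant into two convex cones.
  by_cases hpq : p ≤ 0 ∧ 4 / 3 * p ≤ q
  · exact Or.inl ⟨q - 4 / 3 * p, -(5 / 3 * p), by linarith, by linarith, by ring, by ring⟩
  · refine Or.inr ⟨p - 3 / 4 * q, -(5 / 4 * q), ?_, ?_, by ring, by ring⟩ <;>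
    · rw [not_and_or, not_le, not_le] at hpq
      rcases h with h | h <;> rcases hpq with h' | h' <;> linarith

/-- A frontier point fails a strict condition of some region it lies over. If the same region puts
it into the tile, it lies on a sector face. If the other region does, it lies over both, hence over
a wall: it is then on a wall face, or its dual-plane part vanishes and it is on the axis. -/
lemma subset_surface {τ s : ℝ} (hs : 0 < s) (hs' : s < Real.pi / 6) {x : S3}
    (hx : x ∈ tile τ s \ openTile τ s) :
    x ∈ ⋃ f ∈ faces, sphericalSimplex (vertex τ s) f := by
  obtain ⟨S1, S2, S3, S4⟩ := sin_pos_aux hs hs'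
  obtain ⟨hx, hxo⟩ := hx
  have r1 := turn_relation τ (τ + Real.pi / 6) (τ + s) x
  have r2 := turn_relation τ (τ + Real.pi / 6) (τ + s + Real.pi / 6) x
  have r3 := turn_relation (τ + s) (τ + s + Real.pi / 6) τ x
  have r4 := turn_relation (τ + s) (τ + s + Real.pi / 6) (τ + Real.pi / 6) x
  rw [add_sub_cancel_left, add_sub_cancel_left,
    show τ + Real.pi / 6 - (τ + s) = Real.pi / 6 - s by ring] at r1
  rw [add_sub_cancel_left, show τ + Real.pi / 6 - (τ + s + Real.pi / 6) = -s by ring,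
    show τ + s + Real.pi / 6 - τ = s + Real.pi / 6 by ring, Real.sin_neg] at r2
  rw [add_sub_cancel_left, show τ + s + Real.pi / 6 - τ = s + Real.pi / 6 by ring,
    show τ - (τ + s) = -s by ring, Real.sin_neg] at r3
  rw [add_sub_cancel_left, show τ + s + Real.pi / 6 - (τ + Real.pi / 6) = s by ring,
    show τ + Real.pi / 6 - (τ + s) = Real.pi / 6 - s by ring] at r4
  have hsplit : (((x : E4) 0 ≤ 0 ∨ (x : E4) 1 ≤ 0) ∧
      (turn τ x ≤ 0 ∨ 0 ≤ turn (τ + Real.pi / 6) x)) ∨ ((0 ≤ (x : E4) 0 ∧ 0 ≤ (x : E4) 1) ∧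
      (turn (τ + s) x ≤ 0 ∨ 0 ≤ turn (τ + s + Real.pi / 6) x)) := by
    by_contra h
    rw [not_or, not_and, not_and, not_or, not_or, not_le, not_le, not_le, not_le] at h
    exact hxo h
  set j0 := turn τ x
  set j1 := turn (τ + Real.pi / 6) x
  set k0 := turn (τ + s) x
  set k1 := turn (τ + s + Real.pi / 6) x
  have hcancel : ∀ {p q : ℝ}, 0 < p → p * q = 0 → q = 0 := fun hp h =>
    (mul_eq_zero.1 h).resolve_left hp.ne'
  have sA : 0 < Real.sin (τ + Real.pi / 6 - τ) := by rwa [add_sub_cancel_left]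
  have sB : 0 < Real.sin (τ + s + Real.pi / 6 - (τ + s)) := by rwa [add_sub_cancel_left]
  have sC : 0 < Real.sin (τ + s - τ) := by rwa [add_sub_cancel_left]
  have sD : 0 < Real.sin (τ + s + Real.pi / 6 - (τ + Real.pi / 6)) := by
    rwa [show τ + s + Real.pi / 6 - (τ + Real.pi / 6) = s by ring]
  rcases hsplit with ⟨hP, h | h⟩ | ⟨hQ, h | h⟩
  · have hz : j0 = 0 ∧ j1 ≤ 0 := by
      rcases hx with ⟨-, h1, h2⟩ | ⟨-, h1, h2⟩
      · exact ⟨le_antisymm h h1, h2⟩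
      -- The shifted sector lies in the half-plane `0 ≤ j0` and meets its boundary line only at the
      -- origin. So here `x` is on the axis, where the outer sector face also applies.
      · have a1 : 0 ≤ Real.sin (s + Real.pi / 6) * k0 := mul_nonneg S4.le h1
        have a2 : 0 ≤ Real.sin s * (-k1) := mul_nonneg S1.le (by linarith [h2])
        have a3 : 0 ≤ Real.sin (Real.pi / 6) * (-j0) := mul_nonneg S2.le (by linarith)
        have k0z : k0 = 0 := hcancel S4 (by linarith)
        have k1z : k1 = 0 := neg_eq_zero.1 (hcancel S1 (by linarith : Real.sin s * (-k1) = 0))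
        rw [k0z, k1z] at r3 r4
        exact ⟨hcancel S2 (by linarith), (hcancel S2 (by linarith : _ * j1 = 0)).le⟩
    obtain ⟨e, he, x2, x3⟩ := exists_ray_coeff sA hz.1 hz.2
    rcases exists_outer_coeffs hP with ⟨b, c, hb, hc, x0, x1⟩ | ⟨b, c, hb, hc, x0, x1⟩
    · refine mem_surface ![0, b, c, e, 0, 0, 0] (f := {1, 2, 3}) (by decide) ?_ ?_ ?_
      · apply nonneg_of_components <;> simp <;> assumption
      · intro v; fin_cases v <;> simp
      · apply ext_coord <;> simp [combo_zero, combo_one, combo_two, combo_three, x0, x1, x2, x3]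
    · refine mem_surface ![b, 0, c, e, 0, 0, 0] (f := {0, 2, 3}) (by decide) ?_ ?_ ?_
      · apply nonneg_of_components <;> simp <;> assumption
      · intro v; fin_cases v <;> simp
      · apply ext_coord <;> simp [combo_zero, combo_one, combo_two, combo_three, x0, x1, x2, x3]
  · rcases hx with ⟨-, h1, h2⟩ | ⟨hQ, h1, h2⟩
    · obtain ⟨e, he, x2, x3⟩ := exists_ray_coeff' sA h1 (le_antisymm h2 h)
      rcases exists_outer_coeffs hP with ⟨b, c, hb, hc, x0, x1⟩ | ⟨b, c, hb, hc, x0, x1⟩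
      · refine mem_surface ![0, b, c, 0, 0, e, 0] (f := {1, 2, 5}) (by decide) ?_ ?_ ?_
        · apply nonneg_of_components <;> simp <;> assumption
        · intro v; fin_cases v <;> simp
        · apply ext_coord <;> simp [combo_zero, combo_one, combo_two, combo_three, x0, x1, x2, x3]
      · refine mem_surface ![b, 0, c, 0, 0, e, 0] (f := {0, 2, 5}) (by decide) ?_ ?_ ?_
        · apply nonneg_of_components <;> simp <;> assumption
        · intro v; fin_cases v <;> simp
        · apply ext_coord <;> simp [combo_zero, combo_one, combo_two, combo_three, x0, x1, x2, x3]
    · obtain ⟨e, d, he, hd, x2, x3⟩ := exists_sector_coeffs sD h h2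
      obtain ⟨q0, q1⟩ := hQ
      rcases hP with hP | hP
      · have x0 := le_antisymm hP q0
        · refine mem_surface ![0, (x : E4) 1, 0, 0, 0, e, d] (f := {1, 5, 6}) (by decide) ?_ ?_ ?_
          · apply nonneg_of_components <;> simp <;> assumption
          · intro v; fin_cases v <;> simp
          · apply ext_coord <;> simp [combo_zero, combo_one, combo_two, combo_three, x0, x2, x3]
      · have x1 := le_antisymm hP q1
        · refine mem_surface ![(x : E4) 0, 0, 0, 0, 0, e, d] (f := {0, 5, 6}) (by decide) ?_ ?_ ?_
          · apply nonneg_of_components <;> simp <;> assumption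
          · intro v; fin_cases v <;> simp
          · apply ext_coord <;> simp [combo_zero, combo_one, combo_two, combo_three, x1, x2, x3]
  · obtain ⟨q0, q1⟩ := hQ
    rcases hx with ⟨hP, h1, h2⟩ | ⟨-, h1, h2⟩
    · obtain ⟨e, d, he, hd, x2, x3⟩ := exists_sector_coeffs sC h1 h
      rcases hP with hP | hP
      · have x0 := le_antisymm hP q0
        · refine mem_surface ![0, (x : E4) 1, 0, e, d, 0, 0] (f := {1, 3, 4}) (by decide) ?_ ?_ ?_
          · apply nonneg_of_components <;> simp <;> assumption
          · intro v; fin_cases v <;> simp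
          · apply ext_coord <;> simp [combo_zero, combo_one, combo_two, combo_three, x0, x2, x3]
      · have x1 := le_antisymm hP q1
        · refine mem_surface ![(x : E4) 0, 0, 0, e, d, 0, 0] (f := {0, 3, 4}) (by decide) ?_ ?_ ?_
          · apply nonneg_of_components <;> simp <;> assumption
          · intro v; fin_cases v <;> simp
          · apply ext_coord <;> simp [combo_zero, combo_one, combo_two, combo_three, x1, x2, x3]
    · obtain ⟨e, he, x2, x3⟩ := exists_ray_coeff sB (le_antisymm h h1) h2
      refine mem_surface ![(x : E4) 0, (x : E4) 1, 0, 0, e, 0, 0] (f := {0, 1, 4}) (by decide) ?_ ?_ ?_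
      · apply nonneg_of_components <;> simp <;> assumption
      · intro v; fin_cases v <;> simp
      · apply ext_coord <;> simp [combo_zero, combo_one, combo_two, combo_three, x2, x3]
  · have hz : 0 ≤ k0 ∧ k1 = 0 := by
      rcases hx with ⟨-, h1, h2⟩ | ⟨-, h1, h2⟩
      -- Symmetric to the first case: the base sector meets the half-plane `0 ≤ k1` only at the
      -- origin, so `x` is on the axis.
      · have a1 : 0 ≤ Real.sin s * j0 := mul_nonneg S1.le h1
        have a2 : 0 ≤ Real.sin (s + Real.pi / 6) * (-j1) := mul_nonneg S4.le (by linarith [h2])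
        have a3 : 0 ≤ Real.sin (Real.pi / 6) * k1 := mul_nonneg S2.le (by linarith)
        have j0z : j0 = 0 := hcancel S1 (by linarith)
        have j1z : j1 = 0 :=
          neg_eq_zero.1 (hcancel S4 (by linarith : Real.sin (s + Real.pi / 6) * (-j1) = 0))
        rw [j0z, j1z] at r1 r2
        exact ⟨(hcancel S2 (by linarith : _ * k0 = 0)).ge, hcancel S2 (by linarith)⟩
      · exact ⟨h1, le_antisymm h2 h⟩
    obtain ⟨q0, q1⟩ := hQ
    obtain ⟨e, he, x2, x3⟩ := exists_ray_coeff' sB hz.1 hz.2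
    refine mem_surface ![(x : E4) 0, (x : E4) 1, 0, 0, 0, 0, e] (f := {0, 1, 6}) (by decide) ?_ ?_ ?_
    · apply nonneg_of_components <;> simp <;> assumption
    · intro v; fin_cases v <;> simp
    · apply ext_coord <;> simp [combo_zero, combo_one, combo_two, combo_three, x2, x3]

lemma isPolyhedralTile {τ s : ℝ} (hs : 0 < s) (hs' : s < Real.pi / 6) :
    IsPolyhedralTile faces (vertex τ s) (tile τ s) where
  nondegenerate _ hf := linearIndependent_face hs hs' hf
  embedded _ hf _ hg := simplex_inter hs hs' hf hg
  regular := closure_interior_tile τ s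
  frontier_eq := by
    rw [frontier_tile]
    refine Subset.antisymm (fun x hx => subset_surface hs hs' hx) (iUnion₂_subset fun f hf x hx => ?_)
    exact surface_subset hs hs' hf hx

/-! ### The combinatorial type of the boundary surface -/

lemma faces_card : faces.card = 10 := by decide +kernel

lemma edges_card : (edges faces).card = 15 := by decide +kernel

lemma faces_two : ∀ e ∈ edges faces, (faces.filter fun f => e ⊆ f).card = 2 := by decide +kernel

/-- The links are cycles of length at most six, so three steps, some possibly idle, join any two of
their vertices. Explicit short paths make connectedness a finite check. -/
lemma link_chain : ∀ v a b : Fin 7, {v, a} ∈ edges faces → {v, b} ∈ edges faces →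
    ∃ c d : Fin 7, (a = c ∨ (a ≠ c ∧ {v, a, c} ∈ faces)) ∧ (c = d ∨ (c ≠ d ∧ {v, c, d} ∈ faces)) ∧
      (d = b ∨ (d ≠ b ∧ {v, d, b} ∈ faces)) := by
  decide +kernel

lemma edge_chain : ∀ a b : Fin 7, ∃ c : Fin 7,
    (a = c ∨ (a ≠ c ∧ {a, c} ∈ edges faces)) ∧ (c = b ∨ (c ≠ b ∧ {c, b} ∈ edges faces)) := by
  decide +kernel

lemma isTriangulatedSphere_faces : IsTriangulatedSphere faces where
  card_face := by decide +kernel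
  two_faces := faces_two
  link_connected := by
    intro v a b ha hb
    have step : ∀ a b, (a = b ∨ (a ≠ b ∧ {v, a, b} ∈ faces)) → (linkGraph faces v).Reachable a b := by
      rintro a b (rfl | h)
      · exact SimpleGraph.Reachable.refl _
      · exact SimpleGraph.Adj.reachable h
    obtain ⟨c, d, h1, h2, h3⟩ := link_chain v a b ha hb
    exact (step _ _ h1).trans ((step _ _ h2).trans (step _ _ h3))
  connected := by
    have step : ∀ a b, (a = b ∨ (a ≠ b ∧ {a, b} ∈ edges faces)) →
        (edgeGraph faces).Reachable a b := by
      rintro a b (rfl | h)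
      · exact SimpleGraph.Reachable.refl _
      · exact SimpleGraph.Adj.reachable h
    refine ⟨fun a b => ?_⟩
    obtain ⟨c, h1, h2⟩ := edge_chain a b
    exact (step _ _ h1).trans (step _ _ h2)
  euler := by rw [faces_card, edges_card]; norm_num

/-! ### Dihedral angles -/

lemma hasDihedralAngle_swap_edge {K : Set S3} {a b c d : S3} {α : ℝ}
    (h : HasDihedralAngle K a b c d α) : HasDihedralAngle K b a c d α := by
  obtain ⟨h0, h1, u, v, hu, hv, huv, ua, ub, va, vb, ⟨k, l, m, hm, hc⟩, ⟨k', l', m', hm', hd⟩,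
    hi⟩ := h
  refine ⟨h0, h1, u, v, hu, hv, huv, ub, ua, vb, va, ⟨l, k, m, hm, ?_⟩, ⟨l', k', m', hm', ?_⟩, ?_⟩
  · rw [hc, add_comm (k • (a : E4))]
  · rw [hd, add_comm (k' • (a : E4))]
  · rw [add_comm (b : E4)]; exact hi

/-- Use the reflected frame that starts at the second face: its direction at angle `θ` is the old
direction at angle `α - θ`. -/
lemma hasDihedralAngle_swap_faces {K : Set S3} {a b c d : S3} {α : ℝ}
    (h : HasDihedralAngle K a b c d α) : HasDihedralAngle K a b d c α := by
  obtain ⟨h0, h1, u, v, hu, hv, huv, ua, ub, va, vb, hc, hd, hi⟩ := h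
  have hcs := Real.sin_sq_add_cos_sq α
  have hu2 : inner ℝ u u = 1 := by rw [real_inner_self_eq_norm_sq, hu, one_pow]
  have hv2 : inner ℝ v v = 1 := by rw [real_inner_self_eq_norm_sq, hv, one_pow]
  have hvu : inner ℝ v u = 0 := by rw [real_inner_comm, huv]
  have turned : ∀ θ, Real.cos θ • (Real.cos α • u + Real.sin α • v) +
      Real.sin θ • (Real.sin α • u - Real.cos α • v) =
      Real.cos (α - θ) • u + Real.sin (α - θ) • v := by
    intro θ
    rw [Real.cos_sub, Real.sin_sub]
    module
  refine ⟨h0, h1, Real.cos α • u + Real.sin α • v, Real.sin α • u - Real.cos α • v,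
    ?_, ?_, ?_, ?_, ?_, ?_, ?_, hd, ?_, ?_⟩
  · rw [← sq_eq_sq₀ (norm_nonneg _) zero_le_one, ← real_inner_self_eq_norm_sq]
    simp only [inner_add_left, inner_add_right, inner_smul_left, inner_smul_right, hu2, hv2, huv,
      hvu, conj_trivial]
    linear_combination hcs
  · rw [← sq_eq_sq₀ (norm_nonneg _) zero_le_one, ← real_inner_self_eq_norm_sq]
    simp only [inner_sub_left, inner_sub_right, inner_smul_left, inner_smul_right, hu2, hv2, huv,
      hvu, conj_trivial]
    linear_combination hcs
  · simp only [inner_add_left, inner_sub_right, inner_smul_left, inner_smul_right, hu2, hv2, huv,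
      hvu, conj_trivial]
    ring
  · simp [inner_add_left, inner_smul_left, ua, va]
  · simp [inner_add_left, inner_smul_left, ub, vb]
  · simp [inner_sub_left, inner_smul_left, ua, va]
  · simp [inner_sub_left, inner_smul_left, ub, vb]
  · obtain ⟨k, l, m, hm, hc⟩ := hc
    refine ⟨k, l, m, hm, ?_⟩
    rw [turned, sub_self, Real.cos_zero, Real.sin_zero, one_smul, zero_smul, add_zero, hc]
  · intro θ hθ
    rw [turned]
    exact hi (α - θ) ⟨by linarith [hθ.2], by linarith [hθ.1]⟩

/-- The interior is described by a cone, so points near the edge midpoint may be tested before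
normalisation; they are nonzero because the open cone omits the origin. -/
lemma hasDihedralAngle_tile {τ s α : ℝ} (hα : 0 < α) (hα' : α < 2 * Real.pi) {a b c d : Fin 7}
    (u v : E4) (hu : ‖u‖ = 1) (hv : ‖v‖ = 1) (huv : inner ℝ u v = 0)
    (ua : inner ℝ u (vertexVec τ s a) = 0) (ub : inner ℝ u (vertexVec τ s b) = 0)
    (va : inner ℝ v (vertexVec τ s a) = 0) (vb : inner ℝ v (vertexVec τ s b) = 0)
    (hc : ∃ k l m : ℝ, 0 < m ∧
      vertexVec τ s c = k • vertexVec τ s a + l • vertexVec τ s b + m • u)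
    (hd : ∃ k l m : ℝ, 0 < m ∧ vertexVec τ s d =
      k • vertexVec τ s a + l • vertexVec τ s b + m • (Real.cos α • u + Real.sin α • v))
    (hi : ∀ θ ∈ Ioo 0 α, ∀ᶠ σ : ℝ in 𝓝[>] 0,
      vertexVec τ s a + vertexVec τ s b + σ • (Real.cos θ • u + Real.sin θ • v) ∈
        openTileCone τ s) :
    HasDihedralAngle (tile τ s) (vertex τ s a) (vertex τ s b) (vertex τ s c) (vertex τ s d) α := by
  refine ⟨hα, hα', u, v, hu, hv, huv, ua, ub, va, vb, hc, hd, fun θ hθ => ?_⟩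
  filter_upwards [hi θ hθ] with σ hσ
  change ∃ x ∈ interior (tile τ s), ∃ r : ℝ, 0 < r ∧ (x : E4) =
    r • (vertexVec τ s a + vertexVec τ s b + σ • (Real.cos θ • u + Real.sin θ • v))
  generalize vertexVec τ s a + vertexVec τ s b + σ • (Real.cos θ • u + Real.sin θ • v) = y at hσ ⊢
  have hy : 0 < ‖y‖ := by
    rw [norm_pos_iff]
    rintro rfl
    have := (hσ.1 (Or.inl le_rfl)).1
    simp [turn] at this
  refine ⟨⟨‖y‖⁻¹ • y, ?_⟩, ?_, ‖y‖⁻¹, inv_pos.2 hy, rfl⟩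
  · rw [mem_sphere_zero_iff_norm, norm_smul, norm_inv, norm_norm, inv_mul_cancel₀ hy.ne']
  · rw [interior_tile]
    exact (smul_mem_openTileCone (inv_pos.2 hy)).2 hσ

/-! ### Frames at an edge and perturbation of its midpoint. -/

/-- The unit vector orthogonal to `ray γ` in the plane of the last two coordinates. -/
noncomputable def normal (γ : ℝ) : E4 := vec 0 0 (-Real.sin γ) (Real.cos γ)

lemma norm_normal (γ : ℝ) : ‖normal γ‖ = 1 := by
  apply norm_eq_one_of_coord
  simp [normal, Real.sin_sq_add_cos_sq]

lemma turn_normal_self (γ : ℝ) : turn γ (normal γ) = 1 := by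
  have := Real.sin_sq_add_cos_sq γ
  rw [normal, turn_vec]; linear_combination this

lemma turn_ray_self (γ : ℝ) : turn γ (ray γ) = 0 := by
  rw [turn_ray, sub_self, Real.sin_zero]

lemma ray_add (γ δ : ℝ) : ray (γ + δ) = Real.cos δ • ray γ + Real.sin δ • normal γ := by
  apply ext_coord <;> simp [ray, normal, Real.cos_add, Real.sin_add] <;> ring

lemma ray_eq_of_add (γ δ : ℝ) :
    ray γ = Real.cos δ • ray (γ + δ) + Real.sin δ • -normal (γ + δ) := by
  have h := ray_add (γ + δ) (-δ)
  rw [add_neg_cancel_right, Real.cos_neg, Real.sin_neg] at h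
  rw [smul_neg, ← neg_smul]; exact h

/-- Inequalities strict at the midpoint of an edge survive small displacements. Only those that are
equalities there have to be checked against the direction. -/
lemma eventually_turn_pos {γ : ℝ} {x : E4} (w : E4) (h : 0 < turn γ x) :
    ∀ᶠ σ : ℝ in 𝓝[>] 0, 0 < turn γ (x + σ • w) := by
  have hc : Continuous fun σ : ℝ => turn γ (x + σ • w) :=
    (continuous_turn γ).comp (by fun_prop)
  refine (hc.tendsto 0).mono_left nhdsWithin_le_nhds |>.eventually (lt_mem_nhds ?_)
  simpa using h

lemma eventually_turn_neg {γ : ℝ} {x : E4} (w : E4) (h : turn γ x < 0) :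
    ∀ᶠ σ : ℝ in 𝓝[>] 0, turn γ (x + σ • w) < 0 := by
  have hc : Continuous fun σ : ℝ => turn γ (x + σ • w) :=
    (continuous_turn γ).comp (by fun_prop)
  refine (hc.tendsto 0).mono_left nhdsWithin_le_nhds |>.eventually (gt_mem_nhds ?_)
  simpa using h

lemma eventually_coord_pos {i : Fin 4} {x : E4} (w : E4) (h : 0 < x i) :
    ∀ᶠ σ : ℝ in 𝓝[>] 0, 0 < (x + σ • w) i := by
  have hc : Continuous fun σ : ℝ => (x + σ • w) i := by fun_prop
  refine (hc.tendsto 0).mono_left nhdsWithin_le_nhds |>.eventually (lt_mem_nhds ?_)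
  simpa using h

lemma eventually_coord_neg {i : Fin 4} {x : E4} (w : E4) (h : x i < 0) :
    ∀ᶠ σ : ℝ in 𝓝[>] 0, (x + σ • w) i < 0 := by
  have hc : Continuous fun σ : ℝ => (x + σ • w) i := by fun_prop
  refine (hc.tendsto 0).mono_left nhdsWithin_le_nhds |>.eventually (gt_mem_nhds ?_)
  simpa using h

/-- For reflex edges: the directions of a three-quarter turn fill an open half-plane together with a
region where the sine is positive, so the tight sector condition matters only when the cosine is
nonnegative. -/
lemma sin_pos_of_cos_nonneg {θ : ℝ} (h0 : 0 < θ) (h1 : θ < 3 * Real.pi / 2)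
    (hc : 0 ≤ Real.cos θ) : 0 < Real.sin θ := by
  have hpi := Real.pi_pos
  rcases le_or_gt θ (Real.pi / 2) with h | h
  · exact Real.sin_pos_of_pos_of_lt_pi h0 (by linarith)
  · have := Real.cos_neg_of_pi_div_two_lt_of_lt h (by linarith)
    linarith

lemma cos_three_pi_div_two : Real.cos (3 * Real.pi / 2) = 0 := by
  rw [show 3 * Real.pi / 2 = Real.pi / 2 + Real.pi by ring, Real.cos_add_pi, Real.cos_pi_div_two,
    neg_zero]

lemma sin_three_pi_div_two : Real.sin (3 * Real.pi / 2) = -1 := by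
  rw [show 3 * Real.pi / 2 = Real.pi / 2 + Real.pi by ring, Real.sin_add_pi, Real.sin_pi_div_two]

/-- The membership criterion over the complement of the first quadrant. -/
lemma mem_open_outer {τ s : ℝ} {x : E4} (h : x 0 < 0 ∨ x 1 < 0) (h0 : 0 < turn τ x)
    (h1 : turn (τ + Real.pi / 6) x < 0) : x ∈ openTileCone τ s :=
  ⟨fun _ => ⟨h0, h1⟩, fun hQ => by rcases h with h | h <;> linarith [hQ.1, hQ.2]⟩

/-- The membership criterion over the first quadrant. -/
lemma mem_open_inner {τ s : ℝ} {x : E4} (h : 0 < x 0) (h' : 0 < x 1) (h0 : 0 < turn (τ + s) x)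
    (h1 : turn (τ + s + Real.pi / 6) x < 0) : x ∈ openTileCone τ s :=
  ⟨fun hP => by rcases hP with h | h <;> linarith, fun _ => ⟨h0, h1⟩⟩

lemma turn_plane (γ a b : ℝ) : turn γ (vec a b 0 0) = 0 := by simp [turn]

lemma turn_neg (γ : ℝ) (x : E4) : turn γ (-x) = -turn γ x := by simp [turn]; ring

section

variable (τ s : ℝ)

lemma vertexVec_zero : vertexVec τ s 0 = vec 1 0 0 0 := rfl
lemma vertexVec_one : vertexVec τ s 1 = vec 0 1 0 0 := rfl
lemma vertexVec_two : vertexVec τ s 2 = vec (-(3 / 5)) (-(4 / 5)) 0 0 := rfl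
lemma vertexVec_three : vertexVec τ s 3 = ray τ := rfl
lemma vertexVec_four : vertexVec τ s 4 = ray (τ + s) := rfl
lemma vertexVec_five : vertexVec τ s 5 = ray (τ + Real.pi / 6) := rfl
lemma vertexVec_six : vertexVec τ s 6 = ray (τ + s + Real.pi / 6) := rfl

end

lemma inner_plane_plane (a b c d : ℝ) : inner ℝ (vec a b 0 0) (vec c d 0 0) = a * c + b * d := by
  simp [inner_coord]

lemma inner_plane_ray (a b γ : ℝ) : inner ℝ (vec a b 0 0) (ray γ) = 0 := by
  simp [inner_coord, ray]

lemma inner_ray_plane (a b γ : ℝ) : inner ℝ (ray γ) (vec a b 0 0) = 0 := by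
  simp [inner_coord, ray]

lemma inner_plane_normal (a b γ : ℝ) : inner ℝ (vec a b 0 0) (normal γ) = 0 := by
  simp [inner_coord, normal]

lemma inner_normal_plane (a b γ : ℝ) : inner ℝ (normal γ) (vec a b 0 0) = 0 := by
  simp [inner_coord, normal]

lemma inner_normal_ray (γ : ℝ) : inner ℝ (normal γ) (ray γ) = 0 := by
  simp [inner_coord, normal, ray, mul_comm]

lemma inner_ray_normal (γ : ℝ) : inner ℝ (ray γ) (normal γ) = 0 := by
  simp [inner_coord, normal, ray, mul_comm]

lemma turn_ray_pos {γ β : ℝ} (h : γ < β) (h' : β < γ + Real.pi) : 0 < turn γ (ray β) := by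
  rw [turn_ray]
  exact Real.sin_pos_of_pos_of_lt_pi (by linarith) (by linarith)

lemma turn_ray_neg {γ β : ℝ} (h : β < γ) (h' : γ < β + Real.pi) : turn γ (ray β) < 0 := by
  rw [turn_ray, ← neg_sub, Real.sin_neg, neg_lt_zero]
  exact Real.sin_pos_of_pos_of_lt_pi (by linarith) (by linarith)

/-! ### Edges on the axis. -/

lemma dihedral_axis_right_bottom {τ s : ℝ} (hs : 0 < s) (hs' : s < Real.pi / 6) :
    HasDihedralAngle (tile τ s) (vertex τ s 1) (vertex τ s 2) (vertex τ s 3) (vertex τ s 5)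
      (Real.pi / 6) := by
  have hpi := Real.pi_pos
  refine hasDihedralAngle_tile (by linarith) (by linarith) (ray τ) (normal τ)
    (norm_ray _) (norm_normal _) ?_ ?_ ?_ ?_ ?_
    ⟨0, 0, 1, one_pos, ?_⟩ ⟨0, 0, 1, one_pos, ?_⟩ ?_
  · rw [inner_ray_normal]
  · rw [vertexVec_one, inner_ray_plane]
  · rw [vertexVec_two, inner_ray_plane]
  · rw [vertexVec_one, inner_normal_plane]
  · rw [vertexVec_two, inner_normal_plane]
  · rw [zero_smul, zero_smul, zero_add, zero_add, one_smul, vertexVec_three]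
  · rw [zero_smul, zero_smul, zero_add, zero_add, one_smul, vertexVec_five, ray_add]
  · intro θ hθ
    filter_upwards [self_mem_nhdsWithin] with σ hσ
    have hσ : 0 < σ := hσ
    have hdir : vertexVec τ s 1 + vertexVec τ s 2 +
        σ • (Real.cos θ • ray τ + Real.sin θ • normal τ) =
        vertexVec τ s 1 + vertexVec τ s 2 + σ • ray (τ + θ) := by
      rw [ray_add (τ) θ]
    have hl := mul_pos hσ (turn_ray_pos (γ := τ) (β := τ + θ) (by linarith [hθ.1])
      (by linarith [hθ.2]))
    have hr := mul_neg_of_pos_of_neg hσ (turn_ray_neg (γ := τ + Real.pi / 6) (β := τ + θ)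
      (by linarith [hθ.2]) (by linarith [hθ.1]))
    rw [hdir]
    refine mem_open_outer (Or.inl ?_) ?_ ?_
    · norm_num [vertexVec_one, vertexVec_two, ray]
    · rw [turn_add, turn_add, vertexVec_one,
        vertexVec_two, turn_plane, turn_plane, turn_smul]; linarith [hl]
    · rw [turn_add, turn_add, vertexVec_one,
        vertexVec_two, turn_plane, turn_plane, turn_smul]; linarith [hr]

lemma dihedral_axis_left_bottom {τ s : ℝ} (hs : 0 < s) (hs' : s < Real.pi / 6) :
    HasDihedralAngle (tile τ s) (vertex τ s 0) (vertex τ s 2) (vertex τ s 3) (vertex τ s 5)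
      (Real.pi / 6) := by
  have hpi := Real.pi_pos
  refine hasDihedralAngle_tile (by linarith) (by linarith) (ray τ) (normal τ)
    (norm_ray _) (norm_normal _) ?_ ?_ ?_ ?_ ?_
    ⟨0, 0, 1, one_pos, ?_⟩ ⟨0, 0, 1, one_pos, ?_⟩ ?_
  · rw [inner_ray_normal]
  · rw [vertexVec_zero, inner_ray_plane]
  · rw [vertexVec_two, inner_ray_plane]
  · rw [vertexVec_zero, inner_normal_plane]
  · rw [vertexVec_two, inner_normal_plane]
  · rw [zero_smul, zero_smul, zero_add, zero_add, one_smul, vertexVec_three]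
  · rw [zero_smul, zero_smul, zero_add, zero_add, one_smul, vertexVec_five, ray_add]
  · intro θ hθ
    filter_upwards [self_mem_nhdsWithin] with σ hσ
    have hσ : 0 < σ := hσ
    have hdir : vertexVec τ s 0 + vertexVec τ s 2 +
        σ • (Real.cos θ • ray τ + Real.sin θ • normal τ) =
        vertexVec τ s 0 + vertexVec τ s 2 + σ • ray (τ + θ) := by
      rw [ray_add (τ) θ]
    have hl := mul_pos hσ (turn_ray_pos (γ := τ) (β := τ + θ) (by linarith [hθ.1])
      (by linarith [hθ.2]))
    have hr := mul_neg_of_pos_of_neg hσ (turn_ray_neg (γ := τ + Real.pi / 6) (β := τ + θ)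
      (by linarith [hθ.2]) (by linarith [hθ.1]))
    rw [hdir]
    refine mem_open_outer (Or.inr ?_) ?_ ?_
    · norm_num [vertexVec_zero, vertexVec_two, ray]
    · rw [turn_add, turn_add, vertexVec_zero,
        vertexVec_two, turn_plane, turn_plane, turn_smul]; linarith [hl]
    · rw [turn_add, turn_add, vertexVec_zero,
        vertexVec_two, turn_plane, turn_plane, turn_smul]; linarith [hr]

lemma dihedral_axis_front {τ s : ℝ} (hs : 0 < s) (hs' : s < Real.pi / 6) :
    HasDihedralAngle (tile τ s) (vertex τ s 0) (vertex τ s 1) (vertex τ s 4) (vertex τ s 6)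
      (Real.pi / 6) := by
  have hpi := Real.pi_pos
  refine hasDihedralAngle_tile (by linarith) (by linarith) (ray (τ + s)) (normal (τ + s))
    (norm_ray _) (norm_normal _) ?_ ?_ ?_ ?_ ?_
    ⟨0, 0, 1, one_pos, ?_⟩ ⟨0, 0, 1, one_pos, ?_⟩ ?_
  · rw [inner_ray_normal]
  · rw [vertexVec_zero, inner_ray_plane]
  · rw [vertexVec_one, inner_ray_plane]
  · rw [vertexVec_zero, inner_normal_plane]
  · rw [vertexVec_one, inner_normal_plane]
  · rw [zero_smul, zero_smul, zero_add, zero_add, one_smul, vertexVec_four]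
  · rw [zero_smul, zero_smul, zero_add, zero_add, one_smul, vertexVec_six, ray_add]
  · intro θ hθ
    filter_upwards [self_mem_nhdsWithin] with σ hσ
    have hσ : 0 < σ := hσ
    have hdir : vertexVec τ s 0 + vertexVec τ s 1 +
        σ • (Real.cos θ • ray (τ + s) + Real.sin θ • normal (τ + s)) =
        vertexVec τ s 0 + vertexVec τ s 1 + σ • ray (τ + s + θ) := by
      rw [ray_add (τ + s) θ]
    have hl := mul_pos hσ (turn_ray_pos (γ := τ + s) (β := τ + s + θ) (by linarith [hθ.1])
      (by linarith [hθ.2]))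
    have hr := mul_neg_of_pos_of_neg hσ (turn_ray_neg (γ := τ + s + Real.pi / 6) (β := τ + s + θ)
      (by linarith [hθ.2]) (by linarith [hθ.1]))
    rw [hdir]
    refine mem_open_inner ?_ ?_ ?_ ?_
    · norm_num [vertexVec_zero, vertexVec_one, ray]
    · norm_num [vertexVec_zero, vertexVec_one, ray]
    · rw [turn_add, turn_add, vertexVec_zero,
        vertexVec_one, turn_plane, turn_plane, turn_smul]; linarith [hl]
    · rw [turn_add, turn_add, vertexVec_zero,
        vertexVec_one, turn_plane, turn_plane, turn_smul]; linarith [hr]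

/-! ### Flat edges subdividing the outer sector faces. -/

lemma dihedral_flat_lower {τ s : ℝ} (hs : 0 < s) (hs' : s < Real.pi / 6) :
    HasDihedralAngle (tile τ s) (vertex τ s 3) (vertex τ s 2) (vertex τ s 1) (vertex τ s 0)
      Real.pi := by
  have hpi := Real.pi_pos
  -- The first frame vector spans, with the vertex 2, the axis plane; the vertices 1 and 0 lie on
  -- its positive and negative sides, which gives a straight angle.
  refine hasDihedralAngle_tile (by linarith) (by linarith) (vec (-(4 / 5)) (3 / 5) 0 0) (normal τ)
    (norm_eq_one_of_coord (by norm_num)) (norm_normal _) ?_ ?_ ?_ ?_ ?_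
    ⟨0, -(4 / 5), 3 / 5, by norm_num, ?_⟩ ⟨0, -(3 / 5), 4 / 5, by norm_num, ?_⟩ ?_
  · rw [inner_plane_normal]
  · rw [vertexVec_three, inner_plane_ray]
  · rw [vertexVec_two, inner_plane_plane]; norm_num
  · rw [vertexVec_three, inner_normal_ray]
  · rw [vertexVec_two, inner_normal_plane]
  · apply ext_coord <;> norm_num [vertexVec_three, vertexVec_one, vertexVec_two]
  · apply ext_coord <;> norm_num [vertexVec_three, vertexVec_zero, vertexVec_two]
  · intro θ hθ
    have e1 := eventually_turn_neg (γ := τ + Real.pi / 6) (x := vertexVec τ s 3 + vertexVec τ s 2)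
      (Real.cos θ • vec (-(4 / 5)) (3 / 5) 0 0 + Real.sin θ • normal τ) (by
        rw [turn_add, vertexVec_three, vertexVec_two, turn_plane]
        linarith [turn_ray_neg (γ := τ + Real.pi / 6) (β := τ) (by linarith) (by linarith)])
    have e2 := eventually_coord_neg (i := 0) (x := vertexVec τ s 3 + vertexVec τ s 2)
      (Real.cos θ • vec (-(4 / 5)) (3 / 5) 0 0 + Real.sin θ • normal τ)
          (by norm_num [vertexVec_three, vertexVec_two, ray])
    filter_upwards [e1, e2, self_mem_nhdsWithin] with σ h1 h2 hσ
    have hσ : 0 < σ := hσ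
    have hsin : 0 < Real.sin θ := Real.sin_pos_of_pos_of_lt_pi hθ.1 (by linarith [hθ.2])
    have hj : turn τ (vertexVec τ s 3 + vertexVec τ s 2 + σ •
        (Real.cos θ • vec (-(4 / 5)) (3 / 5) 0 0 + Real.sin θ • normal τ)) =
        σ * Real.sin θ := by
      simp [turn_add, turn_smul, turn_plane, turn_ray_self, turn_normal_self,
          vertexVec_three, vertexVec_two]
    exact mem_open_outer (Or.inl h2) (hj ▸ mul_pos hσ hsin) h1

lemma dihedral_flat_upper {τ s : ℝ} (hs : 0 < s) (hs' : s < Real.pi / 6) :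
    HasDihedralAngle (tile τ s) (vertex τ s 5) (vertex τ s 2) (vertex τ s 1) (vertex τ s 0)
      Real.pi := by
  have hpi := Real.pi_pos
  refine hasDihedralAngle_tile (by linarith) (by linarith)
    (vec (-(4 / 5)) (3 / 5) 0 0) (-normal (τ + Real.pi / 6))
    (norm_eq_one_of_coord (by norm_num)) ((norm_neg _).trans (norm_normal _)) ?_ ?_ ?_ ?_ ?_
    ⟨0, -(4 / 5), 3 / 5, by norm_num, ?_⟩ ⟨0, -(3 / 5), 4 / 5, by norm_num, ?_⟩ ?_
  · rw [inner_neg_right, inner_plane_normal, neg_zero]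
  · rw [vertexVec_five, inner_plane_ray]
  · rw [vertexVec_two, inner_plane_plane]; norm_num
  · rw [vertexVec_five, inner_neg_left, inner_normal_ray, neg_zero]
  · rw [vertexVec_two, inner_neg_left, inner_normal_plane, neg_zero]
  · apply ext_coord <;> norm_num [vertexVec_five, vertexVec_one, vertexVec_two]
  · apply ext_coord <;> norm_num [vertexVec_five, vertexVec_zero, vertexVec_two]
  · intro θ hθ
    have e1 := eventually_turn_pos (γ := τ) (x := vertexVec τ s 5 + vertexVec τ s 2)
      (Real.cos θ • vec (-(4 / 5)) (3 / 5) 0 0 + Real.sin θ • (-normal (τ + Real.pi / 6))) (by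
        rw [turn_add, vertexVec_five, vertexVec_two, turn_plane]
        linarith [turn_ray_pos (γ := τ) (β := τ + Real.pi / 6) (by linarith) (by linarith)])
    have e2 := eventually_coord_neg (i := 0) (x := vertexVec τ s 5 + vertexVec τ s 2)
      (Real.cos θ • vec (-(4 / 5)) (3 / 5) 0 0 + Real.sin θ • (-normal (τ + Real.pi / 6)))
          (by norm_num [vertexVec_five, vertexVec_two, ray])
    filter_upwards [e1, e2, self_mem_nhdsWithin] with σ h1 h2 hσ
    have hσ : 0 < σ := hσ
    have hsin : 0 < Real.sin θ := Real.sin_pos_of_pos_of_lt_pi hθ.1 (by linarith [hθ.2])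
    have hj : turn (τ + Real.pi / 6) (vertexVec τ s 5 + vertexVec τ s 2 +
        σ • (Real.cos θ • vec (-(4 / 5)) (3 / 5) 0 0 + Real.sin θ • (-normal (τ + Real.pi / 6)))) =
        -(σ * Real.sin θ) := by
      simp [turn_add, turn_smul, turn_neg, turn_plane, turn_ray_self, turn_normal_self,
          vertexVec_five, vertexVec_two]
    exact mem_open_outer (Or.inl h2) h1 (hj ▸ neg_neg_of_pos (mul_pos hσ hsin))

/-! ### Edges from the vertex 1 between a sector face and a wall. -/

lemma dihedral_lower_outer_right {τ s : ℝ} (hs : 0 < s) (hs' : s < Real.pi / 6) :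
    HasDihedralAngle (tile τ s) (vertex τ s 3) (vertex τ s 1) (vertex τ s 2) (vertex τ s 4)
      (Real.pi / 2) := by
  have hpi := Real.pi_pos
  have S1 := (sin_pos_aux hs hs').1
  refine hasDihedralAngle_tile (by linarith) (by linarith) (vec (-1) 0 0 0) (normal τ)
    (norm_eq_one_of_coord (by norm_num)) (norm_normal _) ?_ ?_ ?_ ?_ ?_
    ⟨0, -(4 / 5), 3 / 5, by norm_num, ?_⟩ ⟨Real.cos s, 0, Real.sin s, S1, ?_⟩ ?_
  · rw [inner_plane_normal]
  · rw [vertexVec_three, inner_plane_ray]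
  · rw [vertexVec_one, inner_plane_plane]; norm_num
  · rw [vertexVec_three, inner_normal_ray]
  · rw [vertexVec_one, inner_normal_plane]
  · apply ext_coord <;> norm_num [vertexVec_three, vertexVec_one, vertexVec_two]
  · rw [vertexVec_four, ray_add]; simp [vertexVec_three]
  · intro θ hθ
    have hsin : 0 < Real.sin θ := Real.sin_pos_of_pos_of_lt_pi hθ.1 (by linarith [hθ.2])
    have hcos : 0 < Real.cos θ := Real.cos_pos_of_mem_Ioo ⟨by linarith [hθ.1], hθ.2⟩
    have e1 := eventually_turn_neg (γ := τ + Real.pi / 6) (x := vertexVec τ s 3 + vertexVec τ s 1)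
      (Real.cos θ • vec (-1) 0 0 0 + Real.sin θ • normal τ) (by
        rw [turn_add, vertexVec_three, vertexVec_one, turn_plane]
        linarith [turn_ray_neg (γ := τ + Real.pi / 6) (β := τ) (by linarith) (by linarith)])
    filter_upwards [e1, self_mem_nhdsWithin] with σ h1 hσ
    have hσ : 0 < σ := hσ
    have hj : turn τ (vertexVec τ s 3 + vertexVec τ s 1 + σ •
        (Real.cos θ • vec (-1) 0 0 0 + Real.sin θ • normal τ)) =
        σ * Real.sin θ := by
      simp [turn_add, turn_smul, turn_plane, turn_ray_self, turn_normal_self,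
          vertexVec_three, vertexVec_one]
    have hy : (vertexVec τ s 3 + vertexVec τ s 1 + σ •
        (Real.cos θ • vec (-1) 0 0 0 + Real.sin θ • normal τ)) 0 =
        -(σ * Real.cos θ) := by
      simp [vertexVec_three, vertexVec_one, ray, normal]
    exact mem_open_outer (Or.inl (hy ▸ neg_neg_of_pos (mul_pos hσ hcos)))
      (hj ▸ mul_pos hσ hsin) h1

lemma dihedral_upper_outer_right {τ s : ℝ} (hs : 0 < s) (hs' : s < Real.pi / 6) :
    HasDihedralAngle (tile τ s) (vertex τ s 5) (vertex τ s 1) (vertex τ s 2) (vertex τ s 6)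
      (3 * Real.pi / 2) := by
  have hpi := Real.pi_pos
  have S1 := (sin_pos_aux hs hs').1
  refine hasDihedralAngle_tile (by linarith) (by linarith)
    -- On the upper side the tile lies below the face, so the normal is reversed for the rotation to
    -- sweep through the tile.
    (vec (-1) 0 0 0) (-normal (τ + Real.pi / 6))
    (norm_eq_one_of_coord (by norm_num)) ((norm_neg _).trans (norm_normal _)) ?_ ?_ ?_ ?_ ?_
    ⟨0, -(4 / 5), 3 / 5, by norm_num, ?_⟩ ⟨Real.cos s, 0, Real.sin s, S1, ?_⟩ ?_
  · rw [inner_neg_right, inner_plane_normal, neg_zero]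
  · rw [vertexVec_five, inner_plane_ray]
  · rw [vertexVec_one, inner_plane_plane]; norm_num
  · rw [vertexVec_five, inner_neg_left, inner_normal_ray, neg_zero]
  · rw [vertexVec_one, inner_neg_left, inner_normal_plane, neg_zero]
  · apply ext_coord <;> norm_num [vertexVec_five, vertexVec_one, vertexVec_two]
  · rw [vertexVec_six, add_right_comm, ray_add]; simp [vertexVec_five,
      cos_three_pi_div_two, sin_three_pi_div_two]
  · intro θ hθ
    have hsin := fun h => sin_pos_of_cos_nonneg hθ.1 hθ.2 h
    have e1 := eventually_turn_pos (γ := τ) (x := vertexVec τ s 5 + vertexVec τ s 1)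
      (Real.cos θ • vec (-1) 0 0 0 + Real.sin θ • (-normal (τ + Real.pi / 6))) (by
        rw [turn_add, vertexVec_five, vertexVec_one, turn_plane]
        linarith [turn_ray_pos (γ := τ) (β := τ + Real.pi / 6) (by linarith) (by linarith)])
    have e2 := eventually_turn_pos (γ := τ + s) (x := vertexVec τ s 5 + vertexVec τ s 1)
      (Real.cos θ • vec (-1) 0 0 0 + Real.sin θ • (-normal (τ + Real.pi / 6))) (by
        rw [turn_add, vertexVec_five, vertexVec_one, turn_plane]
        linarith [turn_ray_pos (γ := τ + s) (β := τ + Real.pi / 6) (by linarith) (by linarith)])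
    have e3 := eventually_turn_neg (γ := τ + s + Real.pi / 6)
        (x := vertexVec τ s 5 + vertexVec τ s 1)
      (Real.cos θ • vec (-1) 0 0 0 + Real.sin θ • (-normal (τ + Real.pi / 6))) (by
        rw [turn_add, vertexVec_five, vertexVec_one, turn_plane]
        linarith [turn_ray_neg (γ := τ + s + Real.pi / 6) (β := τ + Real.pi / 6) (by linarith)
            (by linarith)])
    have e4 := eventually_coord_pos (i := 1) (x := vertexVec τ s 5 + vertexVec τ s 1)
      (Real.cos θ • vec (-1) 0 0 0 + Real.sin θ • (-normal (τ + Real.pi / 6)))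
          (by norm_num [vertexVec_five, vertexVec_one, ray])
    filter_upwards [e1, e2, e3, e4, self_mem_nhdsWithin] with σ h1 h2 h3 h4 hσ
    have hσ : 0 < σ := hσ
    have hj : turn (τ + Real.pi / 6) (vertexVec τ s 5 + vertexVec τ s 1 +
        σ • (Real.cos θ • vec (-1) 0 0 0 + Real.sin θ • (-normal (τ + Real.pi / 6)))) =
        -(σ * Real.sin θ) := by
      simp [turn_add, turn_smul, turn_neg, turn_plane, turn_ray_self, turn_normal_self,
          vertexVec_five, vertexVec_one]
    have hy : (vertexVec τ s 5 + vertexVec τ s 1 + σ •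
        (Real.cos θ • vec (-1) 0 0 0 + Real.sin θ • (-normal (τ + Real.pi / 6)))) 0 =
        -(σ * Real.cos θ) := by
      simp [vertexVec_five, vertexVec_one, ray, normal]
    -- The ray at `τ + π / 6` is strictly inside the shifted sector, so over the quadrant nothing is
    -- left to check; over its complement the cosine is nonnegative, and so the sine is positive.
    refine ⟨fun hP => ⟨h1, ?_⟩, fun _ => ⟨h2, h3⟩⟩
    rw [hj, neg_lt_zero]
    have hy' := hP.resolve_right h4.not_ge
    rw [hy, neg_nonpos] at hy'
    exact mul_pos hσ (hsin (nonneg_of_mul_nonneg_right hy' hσ))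

lemma dihedral_lower_inner_right {τ s : ℝ} (hs : 0 < s) (hs' : s < Real.pi / 6) :
    HasDihedralAngle (tile τ s) (vertex τ s 4) (vertex τ s 1) (vertex τ s 0) (vertex τ s 3)
      (3 * Real.pi / 2) := by
  have hpi := Real.pi_pos
  have S1 := (sin_pos_aux hs hs').1
  refine hasDihedralAngle_tile (by linarith) (by linarith) (vec 1 0 0 0) (normal (τ + s))
    (norm_eq_one_of_coord (by norm_num)) (norm_normal _) ?_ ?_ ?_ ?_ ?_
    ⟨0, 0, 1, one_pos, ?_⟩ ⟨Real.cos s, 0, Real.sin s, S1, ?_⟩ ?_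
  · rw [inner_plane_normal]
  · rw [vertexVec_four, inner_plane_ray]
  · rw [vertexVec_one, inner_plane_plane]; norm_num
  · rw [vertexVec_four, inner_normal_ray]
  · rw [vertexVec_one, inner_normal_plane]
  · apply ext_coord <;> norm_num [vertexVec_four, vertexVec_one, vertexVec_zero]
  · rw [vertexVec_three, ray_eq_of_add τ s]; simp [vertexVec_four,
      cos_three_pi_div_two, sin_three_pi_div_two]
  · intro θ hθ
    have hsin := fun h => sin_pos_of_cos_nonneg hθ.1 hθ.2 h
    have e1 := eventually_turn_pos (γ := τ) (x := vertexVec τ s 4 + vertexVec τ s 1)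
      (Real.cos θ • vec 1 0 0 0 + Real.sin θ • normal (τ + s)) (by
        rw [turn_add, vertexVec_four, vertexVec_one, turn_plane]
        linarith [turn_ray_pos (γ := τ) (β := τ + s) (by linarith) (by linarith)])
    have e2 := eventually_turn_neg (γ := τ + Real.pi / 6) (x := vertexVec τ s 4 + vertexVec τ s 1)
      (Real.cos θ • vec 1 0 0 0 + Real.sin θ • normal (τ + s)) (by
        rw [turn_add, vertexVec_four, vertexVec_one, turn_plane]
        linarith [turn_ray_neg (γ := τ + Real.pi / 6) (β := τ + s) (by linarith) (by linarith)])
    have e3 := eventually_turn_neg (γ := τ + s + Real.pi / 6)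
        (x := vertexVec τ s 4 + vertexVec τ s 1)
      (Real.cos θ • vec 1 0 0 0 + Real.sin θ • normal (τ + s)) (by
        rw [turn_add, vertexVec_four, vertexVec_one, turn_plane]
        linarith [turn_ray_neg (γ := τ + s + Real.pi / 6) (β := τ + s) (by linarith) (by linarith)])
    filter_upwards [e1, e2, e3, self_mem_nhdsWithin] with σ h1 h2 h3 hσ
    have hσ : 0 < σ := hσ
    have hj : turn (τ + s) (vertexVec τ s 4 + vertexVec τ s 1 + σ •
        (Real.cos θ • vec 1 0 0 0 + Real.sin θ • (normal (τ + s)))) =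
        σ * Real.sin θ := by
      simp [turn_add, turn_smul, turn_plane, turn_ray_self, turn_normal_self,
          vertexVec_four, vertexVec_one]
    have hy : (vertexVec τ s 4 + vertexVec τ s 1 + σ •
        (Real.cos θ • vec 1 0 0 0 + Real.sin θ • (normal (τ + s)))) 0 =
        σ * Real.cos θ := by
      simp [vertexVec_four, vertexVec_one, ray, normal]
    refine ⟨fun _ => ⟨h1, h2⟩, fun hQ => ⟨?_, h3⟩⟩
    rw [hj]
    have hy' := hQ.1
    rw [hy] at hy'
    exact mul_pos hσ (hsin (nonneg_of_mul_nonneg_right hy' hσ))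

lemma dihedral_upper_inner_right {τ s : ℝ} (hs : 0 < s) (hs' : s < Real.pi / 6) :
    HasDihedralAngle (tile τ s) (vertex τ s 6) (vertex τ s 1) (vertex τ s 0) (vertex τ s 5)
      (Real.pi / 2) := by
  have hpi := Real.pi_pos
  have S1 := (sin_pos_aux hs hs').1
  refine hasDihedralAngle_tile (by linarith) (by linarith)
    (vec 1 0 0 0) (-normal (τ + s + Real.pi / 6))
    (norm_eq_one_of_coord (by norm_num)) ((norm_neg _).trans (norm_normal _)) ?_ ?_ ?_ ?_ ?_
    ⟨0, 0, 1, one_pos, ?_⟩ ⟨Real.cos s, 0, Real.sin s, S1, ?_⟩ ?_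
  · rw [inner_neg_right, inner_plane_normal, neg_zero]
  · rw [vertexVec_six, inner_plane_ray]
  · rw [vertexVec_one, inner_plane_plane]; norm_num
  · rw [vertexVec_six, inner_neg_left, inner_normal_ray, neg_zero]
  · rw [vertexVec_one, inner_neg_left, inner_normal_plane, neg_zero]
  · apply ext_coord <;> norm_num [vertexVec_six, vertexVec_one, vertexVec_zero]
  · rw [vertexVec_five, ray_eq_of_add (τ + Real.pi / 6) s, add_right_comm]; simp [vertexVec_six]
  · intro θ hθ
    have hsin : 0 < Real.sin θ := Real.sin_pos_of_pos_of_lt_pi hθ.1 (by linarith [hθ.2])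
    have hcos : 0 < Real.cos θ := Real.cos_pos_of_mem_Ioo ⟨by linarith [hθ.1], hθ.2⟩
    have e1 := eventually_turn_pos (γ := τ + s) (x := vertexVec τ s 6 + vertexVec τ s 1)
      (Real.cos θ • vec 1 0 0 0 + Real.sin θ • (-normal (τ + s + Real.pi / 6))) (by
        rw [turn_add, vertexVec_six, vertexVec_one, turn_plane]
        linarith [turn_ray_pos (γ := τ + s) (β := τ + s + Real.pi / 6) (by linarith) (by linarith)])
    have e2 := eventually_coord_pos (i := 1) (x := vertexVec τ s 6 + vertexVec τ s 1)
      (Real.cos θ • vec 1 0 0 0 + Real.sin θ • (-normal (τ + s + Real.pi / 6)))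
          (by norm_num [vertexVec_six, vertexVec_one, ray])
    filter_upwards [e1, e2, self_mem_nhdsWithin] with σ h1 h2 hσ
    have hσ : 0 < σ := hσ
    have hj : turn (τ + s + Real.pi / 6) (vertexVec τ s 6 + vertexVec τ s 1 +
        σ • (Real.cos θ • vec 1 0 0 0 + Real.sin θ • (-normal (τ + s + Real.pi / 6)))) =
        -(σ * Real.sin θ) := by
      simp [turn_add, turn_smul, turn_neg, turn_plane, turn_ray_self, turn_normal_self,
          vertexVec_six, vertexVec_one]
    have hy : (vertexVec τ s 6 + vertexVec τ s 1 + σ •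
        (Real.cos θ • vec 1 0 0 0 + Real.sin θ • (-normal (τ + s + Real.pi / 6)))) 0 =
        σ * Real.cos θ := by
      simp [vertexVec_six, vertexVec_one, ray, normal]
    exact mem_open_inner (hy ▸ mul_pos hσ hcos) h2 h1
      (hj ▸ neg_neg_of_pos (mul_pos hσ hsin))

/-! ### Edges from the vertex 0, with the coordinates 0 and 1 exchanged. -/

lemma dihedral_lower_outer_left {τ s : ℝ} (hs : 0 < s) (hs' : s < Real.pi / 6) :
    HasDihedralAngle (tile τ s) (vertex τ s 3) (vertex τ s 0) (vertex τ s 2) (vertex τ s 4)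
      (Real.pi / 2) := by
  have hpi := Real.pi_pos
  have S1 := (sin_pos_aux hs hs').1
  refine hasDihedralAngle_tile (by linarith) (by linarith) (vec 0 (-1) 0 0) (normal τ)
    (norm_eq_one_of_coord (by norm_num)) (norm_normal _) ?_ ?_ ?_ ?_ ?_
    ⟨0, -(3 / 5), 4 / 5, by norm_num, ?_⟩ ⟨Real.cos s, 0, Real.sin s, S1, ?_⟩ ?_
  · rw [inner_plane_normal]
  · rw [vertexVec_three, inner_plane_ray]
  · rw [vertexVec_zero, inner_plane_plane]; norm_num
  · rw [vertexVec_three, inner_normal_ray]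
  · rw [vertexVec_zero, inner_normal_plane]
  · apply ext_coord <;> norm_num [vertexVec_three, vertexVec_zero, vertexVec_two]
  · rw [vertexVec_four, ray_add]; simp [vertexVec_three]
  · intro θ hθ
    have hsin : 0 < Real.sin θ := Real.sin_pos_of_pos_of_lt_pi hθ.1 (by linarith [hθ.2])
    have hcos : 0 < Real.cos θ := Real.cos_pos_of_mem_Ioo ⟨by linarith [hθ.1], hθ.2⟩
    have e1 := eventually_turn_neg (γ := τ + Real.pi / 6) (x := vertexVec τ s 3 + vertexVec τ s 0)
      (Real.cos θ • vec 0 (-1) 0 0 + Real.sin θ • normal τ) (by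
        rw [turn_add, vertexVec_three, vertexVec_zero, turn_plane]
        linarith [turn_ray_neg (γ := τ + Real.pi / 6) (β := τ) (by linarith) (by linarith)])
    filter_upwards [e1, self_mem_nhdsWithin] with σ h1 hσ
    have hσ : 0 < σ := hσ
    have hj : turn τ (vertexVec τ s 3 + vertexVec τ s 0 + σ •
        (Real.cos θ • vec 0 (-1) 0 0 + Real.sin θ • normal τ)) =
        σ * Real.sin θ := by
      simp [turn_add, turn_smul, turn_plane, turn_ray_self, turn_normal_self,
          vertexVec_three, vertexVec_zero]
    have hy : (vertexVec τ s 3 + vertexVec τ s 0 + σ •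
        (Real.cos θ • vec 0 (-1) 0 0 + Real.sin θ • normal τ)) 1 =
        -(σ * Real.cos θ) := by
      simp [vertexVec_three, vertexVec_zero, ray, normal]
    exact mem_open_outer (Or.inr (hy ▸ neg_neg_of_pos (mul_pos hσ hcos)))
      (hj ▸ mul_pos hσ hsin) h1

lemma dihedral_upper_outer_left {τ s : ℝ} (hs : 0 < s) (hs' : s < Real.pi / 6) :
    HasDihedralAngle (tile τ s) (vertex τ s 5) (vertex τ s 0) (vertex τ s 2) (vertex τ s 6)
      (3 * Real.pi / 2) := by
  have hpi := Real.pi_pos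
  have S1 := (sin_pos_aux hs hs').1
  refine hasDihedralAngle_tile (by linarith) (by linarith)
    (vec 0 (-1) 0 0) (-normal (τ + Real.pi / 6))
    (norm_eq_one_of_coord (by norm_num)) ((norm_neg _).trans (norm_normal _)) ?_ ?_ ?_ ?_ ?_
    ⟨0, -(3 / 5), 4 / 5, by norm_num, ?_⟩ ⟨Real.cos s, 0, Real.sin s, S1, ?_⟩ ?_
  · rw [inner_neg_right, inner_plane_normal, neg_zero]
  · rw [vertexVec_five, inner_plane_ray]
  · rw [vertexVec_zero, inner_plane_plane]; norm_num
  · rw [vertexVec_five, inner_neg_left, inner_normal_ray, neg_zero]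
  · rw [vertexVec_zero, inner_neg_left, inner_normal_plane, neg_zero]
  · apply ext_coord <;> norm_num [vertexVec_five, vertexVec_zero, vertexVec_two]
  · rw [vertexVec_six, add_right_comm, ray_add]; simp [vertexVec_five,
      cos_three_pi_div_two, sin_three_pi_div_two]
  · intro θ hθ
    have hsin := fun h => sin_pos_of_cos_nonneg hθ.1 hθ.2 h
    have e1 := eventually_turn_pos (γ := τ) (x := vertexVec τ s 5 + vertexVec τ s 0)
      (Real.cos θ • vec 0 (-1) 0 0 + Real.sin θ • (-normal (τ + Real.pi / 6))) (by
        rw [turn_add, vertexVec_five, vertexVec_zero, turn_plane]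
        linarith [turn_ray_pos (γ := τ) (β := τ + Real.pi / 6) (by linarith) (by linarith)])
    have e2 := eventually_turn_pos (γ := τ + s) (x := vertexVec τ s 5 + vertexVec τ s 0)
      (Real.cos θ • vec 0 (-1) 0 0 + Real.sin θ • (-normal (τ + Real.pi / 6))) (by
        rw [turn_add, vertexVec_five, vertexVec_zero, turn_plane]
        linarith [turn_ray_pos (γ := τ + s) (β := τ + Real.pi / 6) (by linarith) (by linarith)])
    have e3 := eventually_turn_neg (γ := τ + s + Real.pi / 6)
        (x := vertexVec τ s 5 + vertexVec τ s 0)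
      (Real.cos θ • vec 0 (-1) 0 0 + Real.sin θ • (-normal (τ + Real.pi / 6))) (by
        rw [turn_add, vertexVec_five, vertexVec_zero, turn_plane]
        linarith [turn_ray_neg (γ := τ + s + Real.pi / 6) (β := τ + Real.pi / 6) (by linarith)
            (by linarith)])
    have e4 := eventually_coord_pos (i := 0) (x := vertexVec τ s 5 + vertexVec τ s 0)
      (Real.cos θ • vec 0 (-1) 0 0 + Real.sin θ • (-normal (τ + Real.pi / 6)))
          (by norm_num [vertexVec_five, vertexVec_zero, ray])
    filter_upwards [e1, e2, e3, e4, self_mem_nhdsWithin] with σ h1 h2 h3 h4 hσ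
    have hσ : 0 < σ := hσ
    have hj : turn (τ + Real.pi / 6) (vertexVec τ s 5 + vertexVec τ s 0 +
        σ • (Real.cos θ • vec 0 (-1) 0 0 + Real.sin θ • (-normal (τ + Real.pi / 6)))) =
        -(σ * Real.sin θ) := by
      simp [turn_add, turn_smul, turn_neg, turn_plane, turn_ray_self, turn_normal_self,
          vertexVec_five, vertexVec_zero]
    have hy : (vertexVec τ s 5 + vertexVec τ s 0 + σ •
        (Real.cos θ • vec 0 (-1) 0 0 + Real.sin θ • (-normal (τ + Real.pi / 6)))) 1 =
        -(σ * Real.cos θ) := by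
      simp [vertexVec_five, vertexVec_zero, ray, normal]
    refine ⟨fun hP => ⟨h1, ?_⟩, fun _ => ⟨h2, h3⟩⟩
    rw [hj, neg_lt_zero]
    have hy' := hP.resolve_left h4.not_ge
    rw [hy, neg_nonpos] at hy'
    exact mul_pos hσ (hsin (nonneg_of_mul_nonneg_right hy' hσ))

lemma dihedral_lower_inner_left {τ s : ℝ} (hs : 0 < s) (hs' : s < Real.pi / 6) :
    HasDihedralAngle (tile τ s) (vertex τ s 4) (vertex τ s 0) (vertex τ s 1) (vertex τ s 3)
      (3 * Real.pi / 2) := by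
  have hpi := Real.pi_pos
  have S1 := (sin_pos_aux hs hs').1
  refine hasDihedralAngle_tile (by linarith) (by linarith) (vec 0 1 0 0) (normal (τ + s))
    (norm_eq_one_of_coord (by norm_num)) (norm_normal _) ?_ ?_ ?_ ?_ ?_
    ⟨0, 0, 1, one_pos, ?_⟩ ⟨Real.cos s, 0, Real.sin s, S1, ?_⟩ ?_
  · rw [inner_plane_normal]
  · rw [vertexVec_four, inner_plane_ray]
  · rw [vertexVec_zero, inner_plane_plane]; norm_num
  · rw [vertexVec_four, inner_normal_ray]
  · rw [vertexVec_zero, inner_normal_plane]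
  · apply ext_coord <;> norm_num [vertexVec_four, vertexVec_zero, vertexVec_one]
  · rw [vertexVec_three, ray_eq_of_add τ s]; simp [vertexVec_four,
      cos_three_pi_div_two, sin_three_pi_div_two]
  · intro θ hθ
    have hsin := fun h => sin_pos_of_cos_nonneg hθ.1 hθ.2 h
    have e1 := eventually_turn_pos (γ := τ) (x := vertexVec τ s 4 + vertexVec τ s 0)
      (Real.cos θ • vec 0 1 0 0 + Real.sin θ • normal (τ + s)) (by
        rw [turn_add, vertexVec_four, vertexVec_zero, turn_plane]
        linarith [turn_ray_pos (γ := τ) (β := τ + s) (by linarith) (by linarith)])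
    have e2 := eventually_turn_neg (γ := τ + Real.pi / 6) (x := vertexVec τ s 4 + vertexVec τ s 0)
      (Real.cos θ • vec 0 1 0 0 + Real.sin θ • normal (τ + s)) (by
        rw [turn_add, vertexVec_four, vertexVec_zero, turn_plane]
        linarith [turn_ray_neg (γ := τ + Real.pi / 6) (β := τ + s) (by linarith) (by linarith)])
    have e3 := eventually_turn_neg (γ := τ + s + Real.pi / 6)
        (x := vertexVec τ s 4 + vertexVec τ s 0)
      (Real.cos θ • vec 0 1 0 0 + Real.sin θ • normal (τ + s)) (by
        rw [turn_add, vertexVec_four, vertexVec_zero, turn_plane]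
        linarith [turn_ray_neg (γ := τ + s + Real.pi / 6) (β := τ + s) (by linarith) (by linarith)])
    filter_upwards [e1, e2, e3, self_mem_nhdsWithin] with σ h1 h2 h3 hσ
    have hσ : 0 < σ := hσ
    have hj : turn (τ + s) (vertexVec τ s 4 + vertexVec τ s 0 + σ •
        (Real.cos θ • vec 0 1 0 0 + Real.sin θ • (normal (τ + s)))) =
        σ * Real.sin θ := by
      simp [turn_add, turn_smul, turn_plane, turn_ray_self, turn_normal_self,
          vertexVec_four, vertexVec_zero]
    have hy : (vertexVec τ s 4 + vertexVec τ s 0 + σ •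
        (Real.cos θ • vec 0 1 0 0 + Real.sin θ • (normal (τ + s)))) 1 =
        σ * Real.cos θ := by
      simp [vertexVec_four, vertexVec_zero, ray, normal]
    refine ⟨fun _ => ⟨h1, h2⟩, fun hQ => ⟨?_, h3⟩⟩
    rw [hj]
    have hy' := hQ.2
    rw [hy] at hy'
    exact mul_pos hσ (hsin (nonneg_of_mul_nonneg_right hy' hσ))

lemma dihedral_upper_inner_left {τ s : ℝ} (hs : 0 < s) (hs' : s < Real.pi / 6) :
    HasDihedralAngle (tile τ s) (vertex τ s 6) (vertex τ s 0) (vertex τ s 1) (vertex τ s 5)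
      (Real.pi / 2) := by
  have hpi := Real.pi_pos
  have S1 := (sin_pos_aux hs hs').1
  refine hasDihedralAngle_tile (by linarith) (by linarith)
    (vec 0 1 0 0) (-normal (τ + s + Real.pi / 6))
    (norm_eq_one_of_coord (by norm_num)) ((norm_neg _).trans (norm_normal _)) ?_ ?_ ?_ ?_ ?_
    ⟨0, 0, 1, one_pos, ?_⟩ ⟨Real.cos s, 0, Real.sin s, S1, ?_⟩ ?_
  · rw [inner_neg_right, inner_plane_normal, neg_zero]
  · rw [vertexVec_six, inner_plane_ray]
  · rw [vertexVec_zero, inner_plane_plane]; norm_num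
  · rw [vertexVec_six, inner_neg_left, inner_normal_ray, neg_zero]
  · rw [vertexVec_zero, inner_neg_left, inner_normal_plane, neg_zero]
  · apply ext_coord <;> norm_num [vertexVec_six, vertexVec_zero, vertexVec_one]
  · rw [vertexVec_five, ray_eq_of_add (τ + Real.pi / 6) s, add_right_comm]; simp [vertexVec_six]
  · intro θ hθ
    have hsin : 0 < Real.sin θ := Real.sin_pos_of_pos_of_lt_pi hθ.1 (by linarith [hθ.2])
    have hcos : 0 < Real.cos θ := Real.cos_pos_of_mem_Ioo ⟨by linarith [hθ.1], hθ.2⟩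
    have e1 := eventually_turn_pos (γ := τ + s) (x := vertexVec τ s 6 + vertexVec τ s 0)
      (Real.cos θ • vec 0 1 0 0 + Real.sin θ • (-normal (τ + s + Real.pi / 6))) (by
        rw [turn_add, vertexVec_six, vertexVec_zero, turn_plane]
        linarith [turn_ray_pos (γ := τ + s) (β := τ + s + Real.pi / 6) (by linarith) (by linarith)])
    have e2 := eventually_coord_pos (i := 0) (x := vertexVec τ s 6 + vertexVec τ s 0)
      (Real.cos θ • vec 0 1 0 0 + Real.sin θ • (-normal (τ + s + Real.pi / 6)))
          (by norm_num [vertexVec_six, vertexVec_zero, ray])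
    filter_upwards [e1, e2, self_mem_nhdsWithin] with σ h1 h2 hσ
    have hσ : 0 < σ := hσ
    have hj : turn (τ + s + Real.pi / 6) (vertexVec τ s 6 + vertexVec τ s 0 +
        σ • (Real.cos θ • vec 0 1 0 0 + Real.sin θ • (-normal (τ + s + Real.pi / 6)))) =
        -(σ * Real.sin θ) := by
      simp [turn_add, turn_smul, turn_neg, turn_plane, turn_ray_self, turn_normal_self,
          vertexVec_six, vertexVec_zero]
    have hy : (vertexVec τ s 6 + vertexVec τ s 0 + σ •
        (Real.cos θ • vec 0 1 0 0 + Real.sin θ • (-normal (τ + s + Real.pi / 6)))) 1 =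
        σ * Real.cos θ := by
      simp [vertexVec_six, vertexVec_zero, ray, normal]
    exact mem_open_inner h2 (hy ▸ mul_pos hσ hcos) h1
      (hj ▸ neg_neg_of_pos (mul_pos hσ hsin))

/-! ### Edges where two walls meet. -/

/-- The edge midpoint is strictly inside the base sector but outside the shifted one. The tile is
therefore locally the complement of the quadrant, a three-quarter turn from `e₀` through `-e₁` to
`e₁`. -/
lemma dihedral_lower_wall {τ s : ℝ} (hs : 0 < s) (hs' : s < Real.pi / 6) :
    HasDihedralAngle (tile τ s) (vertex τ s 3) (vertex τ s 4) (vertex τ s 0) (vertex τ s 1)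
      (3 * Real.pi / 2) := by
  have hpi := Real.pi_pos
  refine hasDihedralAngle_tile (by linarith) (by linarith) (vec 1 0 0 0) (vec 0 (-1) 0 0)
    (norm_eq_one_of_coord (by norm_num)) (norm_eq_one_of_coord (by norm_num)) ?_ ?_ ?_ ?_ ?_
    ⟨0, 0, 1, one_pos, ?_⟩ ⟨0, 0, 1, one_pos, ?_⟩ ?_
  · rw [inner_plane_plane]; norm_num
  · rw [vertexVec_three, inner_plane_ray]
  · rw [vertexVec_four, inner_plane_ray]
  · rw [vertexVec_three, inner_plane_ray]
  · rw [vertexVec_four, inner_plane_ray]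
  · apply ext_coord <;> norm_num [vertexVec_three, vertexVec_four, vertexVec_zero]
  · apply ext_coord <;> simp [vertexVec_three, vertexVec_four, vertexVec_one,
      cos_three_pi_div_two, sin_three_pi_div_two]
  · intro θ hθ
    have hsin := fun h => sin_pos_of_cos_nonneg hθ.1 hθ.2 h
    have e1 := eventually_turn_pos (γ := τ) (x := vertexVec τ s 3 + vertexVec τ s 4)
      (Real.cos θ • vec 1 0 0 0 + Real.sin θ • vec 0 (-1) 0 0) (by
        rw [turn_add, vertexVec_three, vertexVec_four, turn_ray_self]
        linarith [turn_ray_pos (γ := τ) (β := τ + s) (by linarith) (by linarith)])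
    have e2 := eventually_turn_neg (γ := τ + Real.pi / 6) (x := vertexVec τ s 3 + vertexVec τ s 4)
      (Real.cos θ • vec 1 0 0 0 + Real.sin θ • vec 0 (-1) 0 0) (by
        rw [turn_add, vertexVec_three, vertexVec_four]
        linarith [turn_ray_neg (γ := τ + Real.pi / 6) (β := τ) (by linarith) (by linarith),
          turn_ray_neg (γ := τ + Real.pi / 6) (β := τ + s) (by linarith) (by linarith)])
    filter_upwards [e1, e2, self_mem_nhdsWithin] with σ h1 h2 hσ
    have hσ : 0 < σ := hσ
    have hx : (vertexVec τ s 3 + vertexVec τ s 4 + σ •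
        (Real.cos θ • vec 1 0 0 0 + Real.sin θ • (vec 0 (-1) 0 0))) 0 =
        σ * Real.cos θ := by
      simp [vertexVec_three, vertexVec_four, ray]
    have hy : (vertexVec τ s 3 + vertexVec τ s 4 + σ •
        (Real.cos θ • vec 1 0 0 0 + Real.sin θ • (vec 0 (-1) 0 0))) 1 =
        -(σ * Real.sin θ) := by
      simp [vertexVec_three, vertexVec_four, ray]
    refine ⟨fun _ => ⟨h1, h2⟩, fun hQ => ?_⟩
    have hx' := hQ.1
    have hy' := hQ.2
    rw [hx] at hx'
    rw [hy] at hy'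
    linarith [mul_pos hσ (hsin (nonneg_of_mul_nonneg_right hx' hσ))]

/-- Here the midpoint is inside the shifted sector and outside the base one, so the tile is locally
the quadrant itself. -/
lemma dihedral_upper_wall {τ s : ℝ} (hs : 0 < s) (hs' : s < Real.pi / 6) :
    HasDihedralAngle (tile τ s) (vertex τ s 5) (vertex τ s 6) (vertex τ s 0) (vertex τ s 1)
      (Real.pi / 2) := by
  have hpi := Real.pi_pos
  refine hasDihedralAngle_tile (by linarith) (by linarith) (vec 1 0 0 0) (vec 0 1 0 0)
    (norm_eq_one_of_coord (by norm_num)) (norm_eq_one_of_coord (by norm_num)) ?_ ?_ ?_ ?_ ?_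
    ⟨0, 0, 1, one_pos, ?_⟩ ⟨0, 0, 1, one_pos, ?_⟩ ?_
  · rw [inner_plane_plane]; norm_num
  · rw [vertexVec_five, inner_plane_ray]
  · rw [vertexVec_six, inner_plane_ray]
  · rw [vertexVec_five, inner_plane_ray]
  · rw [vertexVec_six, inner_plane_ray]
  · apply ext_coord <;> norm_num [vertexVec_five, vertexVec_six, vertexVec_zero]
  · apply ext_coord <;> simp [vertexVec_five, vertexVec_six, vertexVec_one]
  · intro θ hθ
    have hsin : 0 < Real.sin θ := Real.sin_pos_of_pos_of_lt_pi hθ.1 (by linarith [hθ.2])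
    have hcos : 0 < Real.cos θ := Real.cos_pos_of_mem_Ioo ⟨by linarith [hθ.1], hθ.2⟩
    have e1 := eventually_turn_pos (γ := τ + s) (x := vertexVec τ s 5 + vertexVec τ s 6)
      (Real.cos θ • vec 1 0 0 0 + Real.sin θ • vec 0 1 0 0) (by
        rw [turn_add, vertexVec_five, vertexVec_six]
        linarith [turn_ray_pos (γ := τ + s) (β := τ + Real.pi / 6) (by linarith) (by linarith),
          turn_ray_pos (γ := τ + s) (β := τ + s + Real.pi / 6) (by linarith) (by linarith)])
    have e2 := eventually_turn_neg (γ := τ + s + Real.pi / 6)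
        (x := vertexVec τ s 5 + vertexVec τ s 6)
      (Real.cos θ • vec 1 0 0 0 + Real.sin θ • vec 0 1 0 0) (by
        rw [turn_add, vertexVec_five, vertexVec_six, turn_ray_self]
        linarith [turn_ray_neg (γ := τ + s + Real.pi / 6) (β := τ + Real.pi / 6) (by linarith)
            (by linarith)])
    filter_upwards [e1, e2, self_mem_nhdsWithin] with σ h1 h2 hσ
    have hσ : 0 < σ := hσ
    have hx : (vertexVec τ s 5 + vertexVec τ s 6 + σ •
        (Real.cos θ • vec 1 0 0 0 + Real.sin θ • (vec 0 1 0 0))) 0 =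
        σ * Real.cos θ := by
      simp [vertexVec_five, vertexVec_six, ray]
    have hy : (vertexVec τ s 5 + vertexVec τ s 6 + σ •
        (Real.cos θ • vec 1 0 0 0 + Real.sin θ • (vec 0 1 0 0))) 1 =
        σ * Real.sin θ := by
      simp [vertexVec_five, vertexVec_six, ray]
    exact mem_open_inner (hx ▸ mul_pos hσ hcos) (hy ▸ mul_pos hσ hsin) h1 h2

/-! ### All edges together. -/

/-- One representative for each of the fifteen edges; the rest follows by exchanging the ends of the
edge or its two faces. -/
lemma edge_cases : ∀ a b c d : Fin 7, c ≠ d → {a, b, c} ∈ faces → {a, b, d} ∈ faces →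
    ∃ q ∈ ([(1, 2, 3, 5), (0, 2, 3, 5), (0, 1, 4, 6), (3, 2, 1, 0), (5, 2, 1, 0), (3, 1, 2, 4),
      (5, 1, 2, 6), (4, 1, 0, 3), (6, 1, 0, 5), (3, 0, 2, 4), (5, 0, 2, 6), (4, 0, 1, 3),
      (6, 0, 1, 5), (3, 4, 0, 1), (5, 6, 0, 1)] : List (Fin 7 × Fin 7 × Fin 7 × Fin 7)),
      (a, b, c, d) = q ∨ (b, a, c, d) = q ∨ (a, b, d, c) = q ∨ (b, a, d, c) = q := by
  decide +kernel

/-- The order of quantifiers is the point: the angle is fixed before `τ` and `s`, which is the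
invariance under the deformation. -/
lemma exists_dihedralAngle {a b c d : Fin 7} (hcd : c ≠ d) (hc : {a, b, c} ∈ faces)
    (hd : {a, b, d} ∈ faces) : ∃ α : ℝ, ∀ τ s : ℝ, 0 < s → s < Real.pi / 6 →
      HasDihedralAngle (tile τ s) (vertex τ s a) (vertex τ s b) (vertex τ s c) (vertex τ s d) α :=
          by
  obtain ⟨⟨a', b', c', d'⟩, hq, h⟩ := edge_cases a b c d hcd hc hd
  have hα : ∃ α : ℝ, ∀ τ s : ℝ, 0 < s → s < Real.pi / 6 → HasDihedralAngle (tile τ s)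
      (vertex τ s a') (vertex τ s b') (vertex τ s c') (vertex τ s d') α := by
    simp only [List.mem_cons, Prod.mk.injEq, List.not_mem_nil, or_false] at hq
    rcases hq with ⟨rfl, rfl, rfl, rfl⟩ | ⟨rfl, rfl, rfl, rfl⟩ | ⟨rfl, rfl, rfl, rfl⟩ |
      ⟨rfl, rfl, rfl, rfl⟩ | ⟨rfl, rfl, rfl, rfl⟩ | ⟨rfl, rfl, rfl, rfl⟩ | ⟨rfl, rfl, rfl, rfl⟩ |
      ⟨rfl, rfl, rfl, rfl⟩ | ⟨rfl, rfl, rfl, rfl⟩ | ⟨rfl, rfl, rfl, rfl⟩ | ⟨rfl, rfl, rfl, rfl⟩ |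
      ⟨rfl, rfl, rfl, rfl⟩ | ⟨rfl, rfl, rfl, rfl⟩ | ⟨rfl, rfl, rfl, rfl⟩ | ⟨rfl, rfl, rfl, rfl⟩
    · exact ⟨_, fun _ _ => dihedral_axis_right_bottom⟩
    · exact ⟨_, fun _ _ => dihedral_axis_left_bottom⟩
    · exact ⟨_, fun _ _ => dihedral_axis_front⟩
    · exact ⟨_, fun _ _ => dihedral_flat_lower⟩
    · exact ⟨_, fun _ _ => dihedral_flat_upper⟩
    · exact ⟨_, fun _ _ => dihedral_lower_outer_right⟩
    · exact ⟨_, fun _ _ => dihedral_upper_outer_right⟩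
    · exact ⟨_, fun _ _ => dihedral_lower_inner_right⟩
    · exact ⟨_, fun _ _ => dihedral_upper_inner_right⟩
    · exact ⟨_, fun _ _ => dihedral_lower_outer_left⟩
    · exact ⟨_, fun _ _ => dihedral_upper_outer_left⟩
    · exact ⟨_, fun _ _ => dihedral_lower_inner_left⟩
    · exact ⟨_, fun _ _ => dihedral_upper_inner_left⟩
    · exact ⟨_, fun _ _ => dihedral_lower_wall⟩
    · exact ⟨_, fun _ _ => dihedral_upper_wall⟩
  obtain ⟨α, hα⟩ := hα
  refine ⟨α, fun τ s hs hs' => ?_⟩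
  have h1 := hα τ s hs hs'
  simp only [Prod.mk.injEq] at h
  rcases h with ⟨rfl, rfl, rfl, rfl⟩ | ⟨rfl, rfl, rfl, rfl⟩ | ⟨rfl, rfl, rfl, rfl⟩ |
    ⟨rfl, rfl, rfl, rfl⟩
  · exact h1
  · exact hasDihedralAngle_swap_edge h1
  · exact hasDihedralAngle_swap_faces h1
  · exact hasDihedralAngle_swap_edge (hasDihedralAngle_swap_faces h1)

/-! ### Continuity -/

lemma continuous_ray : Continuous ray := by
  unfold ray vec
  refine (PiLp.continuous_toLp 2 _).comp (continuous_pi fun i => ?_)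
  fin_cases i
  · exact continuous_const
  · exact continuous_const
  · exact Real.continuous_cos
  · exact Real.continuous_sin

lemma continuous_vertex (τ : ℝ) (v : Fin 7) : Continuous fun s => vertex τ s v := by
  refine Continuous.subtype_mk ?_ _
  fin_cases v
  · exact continuous_const
  · exact continuous_const
  · exact continuous_const
  · exact continuous_const
  · exact continuous_ray.comp (by fun_prop)
  · exact continuous_const
  · exact continuous_ray.comp (by fun_prop)

/-! ### The tiling -/

lemma turn_add_pi (γ : ℝ) (x : E4) : turn (γ + Real.pi) x = -turn γ x := by
  simp only [turn, Real.cos_add_pi, Real.sin_add_pi]; ring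

lemma turn_add_two_pi (γ : ℝ) (x : E4) : turn (γ + 2 * Real.pi) x = turn γ x := by
  simp only [turn, Real.cos_add_two_pi, Real.sin_add_two_pi]

/-- If no sector contained `x`, nonnegativity of `turn` would propagate from each of the twelve rays
to the next. Six steps reach the opposite ray, where the sign must be reversed. -/
lemma exists_sector (τ : ℝ) (x : E4) : ∃ i : Fin 12,
    0 ≤ turn (τ + i * (Real.pi / 6)) x ∧ turn (τ + i * (Real.pi / 6) + Real.pi / 6) x ≤ 0 := by
  by_contra! h
  have step : ∀ n : ℕ, n < 12 → 0 ≤ turn (τ + n * (Real.pi / 6)) x →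
      0 < turn (τ + (n + 1 : ℕ) * (Real.pi / 6)) x := by
    intro n hn h0
    have := h ⟨n, hn⟩ h0
    rwa [show τ + (n + 1 : ℕ) * (Real.pi / 6) = τ + n * (Real.pi / 6) + Real.pi / 6 by
      push_cast; ring]
  have opp : ∀ n : ℕ, turn (τ + (n + 6 : ℕ) * (Real.pi / 6)) x = -turn (τ + n * (Real.pi / 6)) x := by
    intro n
    rw [← turn_add_pi]; congr 1; push_cast; ring
  have six : ∀ n : ℕ, n ≤ 6 → 0 ≤ turn (τ + n * (Real.pi / 6)) x →
      0 < turn (τ + (n + 6 : ℕ) * (Real.pi / 6)) x := by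
    intro n hn h0
    have h1 := step n (by omega) h0
    have h2 := step _ (by omega) h1.le
    have h3 := step _ (by omega) h2.le
    have h4 := step _ (by omega) h3.le
    have h5 := step _ (by omega) h4.le
    exact step _ (by omega) h5.le
  have o0 := opp 0
  have o6 := opp 6
  rcases le_or_gt 0 (turn (τ + (0 : ℕ) * (Real.pi / 6)) x) with h0 | h0
  · have := six 0 (by omega) h0
    linarith
  -- If the sign at the initial ray is negative, start from the opposite ray; the six steps end at
  -- the initial ray after a full turn.
  · have := six 6 le_rfl (by linarith)
    linarith

lemma turn_nonpos_of_open_sector {α γ : ℝ} {x : E4} (h1 : Real.pi / 6 ≤ γ - α)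
    (h2 : γ - α ≤ Real.pi) (h3 : 0 < turn α x) (h4 : turn (α + Real.pi / 6) x < 0) :
    turn γ x ≤ 0 := by
  have hpi := Real.pi_pos
  have r := turn_relation α (α + Real.pi / 6) γ x
  rw [add_sub_cancel_left, show α + Real.pi / 6 - γ = -(γ - α - Real.pi / 6) by ring,
    Real.sin_neg] at r
  have s0 : 0 < Real.sin (Real.pi / 6) := Real.sin_pos_of_pos_of_lt_pi (by linarith) (by linarith)
  have s1 : 0 ≤ Real.sin (γ - α - Real.pi / 6) :=
    Real.sin_nonneg_of_nonneg_of_le_pi (by linarith) (by linarith)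
  have s2 : 0 ≤ Real.sin (γ - α) := Real.sin_nonneg_of_nonneg_of_le_pi (by linarith) h2
  by_contra! h
  nlinarith [mul_pos s0 h, mul_nonneg s1 h3.le, mul_nonneg s2 (neg_nonneg.2 h4.le)]

lemma open_sectors_disjoint_of_lt {i j : Fin 12} (hij : i < j) (τ : ℝ) (x : E4)
    (h1 : 0 < turn (τ + i * (Real.pi / 6)) x)
    (h2 : turn (τ + i * (Real.pi / 6) + Real.pi / 6) x < 0)
    (h3 : 0 < turn (τ + j * (Real.pi / 6)) x)
    (h4 : turn (τ + j * (Real.pi / 6) + Real.pi / 6) x < 0) : False := by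
  have hpi := Real.pi_pos
  have hij' : (i : ℝ) + 1 ≤ j := by exact_mod_cast (hij : (i : ℕ) < j)
  have hj : (j : ℝ) ≤ 11 := by exact_mod_cast Nat.lt_succ_iff.1 j.2
  have hi : (0 : ℝ) ≤ i := by positivity
  rcases le_total ((j : ℝ) - i) 6 with h | h
  · have := turn_nonpos_of_open_sector (γ := τ + j * (Real.pi / 6)) (by nlinarith) (by nlinarith)
      h1 h2
    linarith
  -- When `j` is at least six steps ahead of `i`, go on from `j` around the circle to `i`; this
  -- takes between one and six steps.
  · have := turn_nonpos_of_open_sector (γ := τ + i * (Real.pi / 6) + 2 * Real.pi)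
      (by nlinarith) (by nlinarith) h3 h4
    rw [turn_add_two_pi] at this
    linarith

lemma open_sectors_disjoint {i j : Fin 12} (hij : i ≠ j) (τ : ℝ) (x : E4)
    (h1 : 0 < turn (τ + i * (Real.pi / 6)) x ∧ turn (τ + i * (Real.pi / 6) + Real.pi / 6) x < 0)
    (h2 : 0 < turn (τ + j * (Real.pi / 6)) x ∧ turn (τ + j * (Real.pi / 6) + Real.pi / 6) x < 0) :
    False := by
  rcases lt_or_gt_of_ne hij with h | h
  · exact open_sectors_disjoint_of_lt h τ x h1.1 h1.2 h2.1 h2.2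
  · exact open_sectors_disjoint_of_lt h τ x h2.1 h2.2 h1.1 h1.2

/-- Over each region the tiles are twelve consecutive sectors around the circle, beginning at `0` or
at `s`. Covering and disjointness are checked region by region and do not depend on `s`. -/
lemma isTiling_tile (s : ℝ) : IsTiling fun i : Fin 12 => tile (i * (Real.pi / 6)) s := by
  constructor
  · refine eq_univ_of_forall fun x => mem_iUnion.2 ?_
    by_cases hP : (x : E4) 0 ≤ 0 ∨ (x : E4) 1 ≤ 0
    · obtain ⟨i, h1, h2⟩ := exists_sector 0 (x : E4)
      rw [zero_add] at h1 h2
      exact ⟨i, Or.inl ⟨hP, h1, h2⟩⟩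
    · rw [not_or, not_le, not_le] at hP
      obtain ⟨i, h1, h2⟩ := exists_sector s (x : E4)
      rw [add_comm s] at h1 h2
      exact ⟨i, Or.inr ⟨⟨hP.1.le, hP.2.le⟩, h1, h2⟩⟩
  · intro i j hij
    simp only [interior_tile]
    refine disjoint_left.2 fun x hi hj => ?_
    by_cases hP : (x : E4) 0 ≤ 0 ∨ (x : E4) 1 ≤ 0
    · refine open_sectors_disjoint hij 0 (x : E4) ?_ ?_ <;> rw [zero_add]
      exacts [hi.1 hP, hj.1 hP]
    · rw [not_or, not_le, not_le] at hP
      have hQ : 0 ≤ (x : E4) 0 ∧ 0 ≤ (x : E4) 1 := ⟨hP.1.le, hP.2.le⟩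
      refine open_sectors_disjoint hij s (x : E4) ?_ ?_ <;> rw [add_comm s]
      exacts [hi.2 hQ, hj.2 hQ]

/-! ### Congruence of the tiles -/

/-- The rotation by `ρ` of the plane of the last two coordinates. -/
noncomputable def rotLinear (ρ : ℝ) : E4 →ₗ[ℝ] E4 where
  toFun x := vec (x 0) (x 1) (Real.cos ρ * x 2 - Real.sin ρ * x 3)
    (Real.sin ρ * x 2 + Real.cos ρ * x 3)
  map_add' x y := by apply ext_coord <;> simp <;> ring
  map_smul' r x := by apply ext_coord <;> simp <;> ring

lemma rotLinear_neg_apply (ρ : ℝ) (x : E4) : rotLinear ρ (rotLinear (-ρ) x) = x := by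
  have h := Real.sin_sq_add_cos_sq ρ
  apply ext_coord <;> simp [rotLinear]
  · linear_combination (x 2) * h
  · linear_combination (x 3) * h

/-- The rotation by `ρ` of the plane of the last two coordinates, as an isometry. -/
noncomputable def rot (ρ : ℝ) : E4 ≃ₗᵢ[ℝ] E4 where
  toLinearEquiv := LinearEquiv.ofLinearMap (rotLinear ρ) (rotLinear (-ρ))
    (LinearMap.ext fun x => rotLinear_neg_apply ρ x)
    (LinearMap.ext fun x => by simpa using rotLinear_neg_apply (-ρ) x)
  norm_map' x := by
    have h := Real.sin_sq_add_cos_sq ρ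
    change ‖rotLinear ρ x‖ = ‖x‖
    rw [← sq_eq_sq₀ (norm_nonneg _) (norm_nonneg _), norm_sq_coord, norm_sq_coord]
    simp only [rotLinear, LinearMap.coe_mk, AddHom.coe_mk, vec_zero, vec_one, vec_two, vec_three]
    linear_combination (x 2 ^ 2 + x 3 ^ 2) * h

lemma turn_rot (γ ρ : ℝ) (x : E4) : turn γ (rot ρ x) = turn (γ - ρ) x := by
  change Real.cos γ * (Real.sin ρ * x 2 + Real.cos ρ * x 3) -
    Real.sin γ * (Real.cos ρ * x 2 - Real.sin ρ * x 3) = _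
  simp only [turn, Real.cos_sub, Real.sin_sub]; ring

lemma rot_mem_tileCone (τ τ' s : ℝ) (x : E4) :
    rot (τ' - τ) x ∈ tileCone τ' s ↔ x ∈ tileCone τ s := by
  have h0 : rot (τ' - τ) x 0 = x 0 := rfl
  have h1 : rot (τ' - τ) x 1 = x 1 := rfl
  simp only [tileCone, mem_ofPred_eq, h0, h1, turn_rot]
  rw [show τ' - (τ' - τ) = τ by ring, show τ' + Real.pi / 6 - (τ' - τ) = τ + Real.pi / 6 by ring,
    show τ' + s - (τ' - τ) = τ + s by ring,
    show τ' + s + Real.pi / 6 - (τ' - τ) = τ + s + Real.pi / 6 by ring]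

lemma congruentSets_tile (τ τ' s : ℝ) : CongruentSets (tile τ s) (tile τ' s) := by
  refine ⟨rot (τ' - τ), Subset.antisymm ?_ ?_⟩
  · rintro _ ⟨x, hx, rfl⟩
    refine ⟨⟨rot (τ' - τ) x, ?_⟩, (rot_mem_tileCone τ τ' s x).2 hx, rfl⟩
    rw [mem_sphere_zero_iff_norm, LinearIsometryEquiv.norm_map, norm_eq_of_mem_sphere]
  · rintro _ ⟨y, hy, rfl⟩
    have hval : rot (τ' - τ) ((rot (τ' - τ)).symm (y : E4)) = y :=
      LinearIsometryEquiv.apply_symm_apply _ _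
    refine ⟨⟨(rot (τ' - τ)).symm (y : E4), ?_⟩, (rot_mem_tileCone τ τ' s _).1 ?_, hval⟩
    · rw [mem_sphere_zero_iff_norm, LinearIsometryEquiv.norm_map, norm_eq_of_mem_sphere]
    · change rot (τ' - τ) ((rot (τ' - τ)).symm (y : E4)) ∈ _
      rw [hval]; exact hy

/-! ### Tiles with different shifts are not congruent -/

lemma wide_sector_of_mem {τ s : ℝ} (hs : 0 < s) (hs' : s < Real.pi / 6) {x : E4}
    (hx : x ∈ tileCone τ s) : 0 ≤ turn τ x ∧ turn (τ + s + Real.pi / 6) x ≤ 0 := by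
  obtain ⟨S1, S2, S3, S4⟩ := sin_pos_aux hs hs'
  rcases hx with ⟨-, h1, h2⟩ | ⟨-, h1, h2⟩
  · refine ⟨h1, ?_⟩
    have r := turn_relation τ (τ + Real.pi / 6) (τ + s + Real.pi / 6) x
    rw [add_sub_cancel_left, show τ + Real.pi / 6 - (τ + s + Real.pi / 6) = -s by ring,
      show τ + s + Real.pi / 6 - τ = s + Real.pi / 6 by ring, Real.sin_neg] at r
    by_contra! h
    linarith [mul_pos S2 h, mul_nonneg S1.le h1, mul_nonneg S4.le (neg_nonneg.2 h2)]
  · refine ⟨?_, h2⟩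
    have r := turn_relation (τ + s) (τ + s + Real.pi / 6) τ x
    rw [add_sub_cancel_left, show τ + s + Real.pi / 6 - τ = s + Real.pi / 6 by ring,
      show τ - (τ + s) = -s by ring, Real.sin_neg] at r
    by_contra! h
    linarith [mul_pos S2 (neg_pos.2 h), mul_nonneg S4.le h1, mul_nonneg S1.le (neg_nonneg.2 h2)]

/-- Both sectors lie in one sector of width `s + π / 6 < π`, which contains no opposite nonzero
vectors. Conversely the whole axis lies in the tile, so antipodal pairs recognise the axis in a way
that isometries preserve. -/
lemma planar_zero_of_mem_of_neg_mem {τ s : ℝ} (hs : 0 < s) (hs' : s < Real.pi / 6) {x : E4}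
    (hx : x ∈ tileCone τ s) (hx' : -x ∈ tileCone τ s) : x 2 = 0 ∧ x 3 = 0 := by
  obtain ⟨S1, S2, S3, S4⟩ := sin_pos_aux hs hs'
  obtain ⟨h1, h2⟩ := wide_sector_of_mem hs hs' hx
  obtain ⟨h3, h4⟩ := wide_sector_of_mem hs hs' hx'
  rw [turn_neg] at h3 h4
  have e1 : turn τ x = 0 := by linarith
  have e2 : turn (τ + s + Real.pi / 6) x = 0 := by linarith
  have x2 := planar_expansion_two τ (τ + s + Real.pi / 6) x
  have x3 := planar_expansion_three τ (τ + s + Real.pi / 6) x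
  rw [show τ + s + Real.pi / 6 - τ = s + Real.pi / 6 by ring, e1, e2, zero_mul, zero_mul, sub_zero]
    at x2 x3
  exact ⟨(mul_eq_zero.1 x2).resolve_left S4.ne', (mul_eq_zero.1 x3).resolve_left S4.ne'⟩

lemma mem_tileCone_of_planar_zero (τ s a b : ℝ) : vec a b 0 0 ∈ tileCone τ s := by
  simp only [tileCone, mem_ofPred_eq, turn_plane, le_refl, and_true, vec_zero, vec_one]
  rcases le_total a 0 with h | h
  · exact Or.inl (Or.inl h)
  · rcases le_total b 0 with h' | h'
    · exact Or.inl (Or.inr h')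
    · exact Or.inr ⟨h, h'⟩

/-- Two unit vectors in the cone on two unit vectors with inner product `c` are no further apart
than the generators. Their squared inner product and squared area add up to one, and the area is at
most that of the generators. -/
lemma cos_le_of_unit_combinations {a b a' b' c : ℝ} (hc : 0 ≤ c) (ha : 0 ≤ a) (hb : 0 ≤ b)
    (ha' : 0 ≤ a') (hb' : 0 ≤ b') (hc1 : c ≤ 1) (h : a ^ 2 + b ^ 2 + 2 * a * b * c = 1)
    (h' : a' ^ 2 + b' ^ 2 + 2 * a' * b' * c = 1) :
    c ≤ a * a' + b * b' + (a * b' + a' * b) * c := by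
  have bound : ∀ {p q : ℝ}, 0 ≤ p → 0 ≤ q → p ^ 2 + q ^ 2 + 2 * p * q * c = 1 → p ≤ 1 ∧ q ≤ 1 := by
    intro p q hp hq hpq
    have := mul_nonneg (mul_nonneg hp hq) hc
    constructor <;> nlinarith
  obtain ⟨a1, b1⟩ := bound ha hb h
  obtain ⟨a1', b1'⟩ := bound ha' hb' h'
  have u1 : 0 ≤ a * b' := mul_nonneg ha hb'
  have u2 : 0 ≤ a' * b := mul_nonneg ha' hb
  have u3 : a * b' ≤ 1 := mul_le_one₀ a1 hb' b1'
  have u4 : a' * b ≤ 1 := mul_le_one₀ a1' hb b1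
  have hcross : (a * b' - a' * b) ^ 2 ≤ 1 := by nlinarith
  -- Lagrange's identity for the two combinations: `a * b' - a' * b` is their determinant in the
  -- generators, and `1 - c ^ 2` is the Gram determinant of the generators.
  have key : (a * a' + b * b' + (a * b' + a' * b) * c) ^ 2 +
      (a * b' - a' * b) ^ 2 * (1 - c ^ 2) = 1 := by
    linear_combination (a' ^ 2 + b' ^ 2 + 2 * a' * b' * c) * h + h'
  have hc2 : 0 ≤ 1 - c ^ 2 := by nlinarith
  refine le_of_sq_le_sq ?_ (by positivity)
  nlinarith [mul_le_mul_of_nonneg_right hcross hc2]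

lemma cos_le_inner_of_mem {τ s : ℝ} (hs : 0 < s) (hs' : s < Real.pi / 6) {x y : S3}
    (hx : x ∈ tile τ s) (hy : y ∈ tile τ s) (x0 : (x : E4) 0 = 0) (x1 : (x : E4) 1 = 0)
    (y0 : (y : E4) 0 = 0) (y1 : (y : E4) 1 = 0) :
    Real.cos (s + Real.pi / 6) ≤ inner ℝ (x : E4) (y : E4) := by
  have hpi := Real.pi_pos
  obtain ⟨S1, S2, S3, S4⟩ := sin_pos_aux hs hs'
  have S5 : 0 < Real.sin (τ + s + Real.pi / 6 - τ) := by
    rwa [show τ + s + Real.pi / 6 - τ = s + Real.pi / 6 by ring]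
  obtain ⟨hx1, hx2⟩ := wide_sector_of_mem hs hs' hx
  obtain ⟨hy1, hy2⟩ := wide_sector_of_mem hs hs' hy
  obtain ⟨a, b, ha, hb, x2, x3⟩ := exists_sector_coeffs S5 hx1 hx2
  obtain ⟨a', b', ha', hb', y2, y3⟩ := exists_sector_coeffs S5 hy1 hy2
  have nx := coord_sq_sum x
  have ny := coord_sq_sum y
  rw [x0, x1, x2, x3] at nx
  rw [y0, y1, y2, y3] at ny
  rw [inner_coord, x0, x1, x2, x3, y2, y3]
  have hcos : Real.cos (s + Real.pi / 6) = Real.cos (τ + s + Real.pi / 6) * Real.cos τ +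
      Real.sin (τ + s + Real.pi / 6) * Real.sin τ := by
    rw [← Real.cos_sub]; congr 1; ring
  have p1 := Real.sin_sq_add_cos_sq τ
  have p2 := Real.sin_sq_add_cos_sq (τ + s + Real.pi / 6)
  have c0 : 0 ≤ Real.cos (s + Real.pi / 6) :=
    Real.cos_nonneg_of_mem_Icc ⟨by linarith, by linarith⟩
  refine (cos_le_of_unit_combinations (a := a) (b := b) (a' := a') (b' := b') c0 ha hb ha' hb'
    (Real.cos_le_one _) ?_ ?_).trans_eq ?_ <;> rw [hcos]
  · linear_combination nx - a ^ 2 * p1 - b ^ 2 * p2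
  · linear_combination ny - a' ^ 2 * p1 - b' ^ 2 * p2
  · linear_combination - a * a' * p1 - b * b' * p2

/-- A congruence maps the axis into the axis, so preimages of points of the dual circle lie on the
dual circle. The ends of the longer arc, `s' + π / 6`, would come from two points of an arc of
length `s + π / 6`. -/
lemma not_congruentSets_tile {τ τ' s s' : ℝ} (hs : 0 < s) (hss : s < s') (hs' : s' < Real.pi / 6) :
    ¬ CongruentSets (tile τ s) (tile τ' s') := by
  rintro ⟨g, hg⟩
  have hpi := Real.pi_pos
  have hs0 : 0 < s' := hs.trans hss
  have fwd : ∀ x : E4, ‖x‖ = 1 → x ∈ tileCone τ s → g x ∈ tileCone τ' s' := by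
    intro x hx hm
    have : g x ∈ (fun x : S3 => (x : E4)) '' tile τ' s' := by
      rw [← hg]
      exact ⟨⟨x, by rwa [mem_sphere_zero_iff_norm]⟩, hm, rfl⟩
    obtain ⟨y, hy, hyx⟩ := this
    rw [← hyx]; exact hy
  have axis : ∀ a b : ℝ, ‖vec a b 0 0‖ = 1 → g (vec a b 0 0) 2 = 0 ∧ g (vec a b 0 0) 3 = 0 := by
    intro a b hab
    have hneg : -vec a b 0 0 = vec (-a) (-b) 0 0 := by apply ext_coord <;> simp
    refine planar_zero_of_mem_of_neg_mem hs0 hs'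
      (fwd _ hab (mem_tileCone_of_planar_zero τ s a b)) ?_
    rw [← map_neg]
    refine fwd _ (by rw [norm_neg, hab]) ?_
    rw [hneg]; exact mem_tileCone_of_planar_zero τ s _ _
  have pull : ∀ γ, ray γ ∈ tileCone τ' s' →
      ∃ x ∈ tile τ s, g (x : E4) = ray γ ∧ (x : E4) 0 = 0 ∧ (x : E4) 1 = 0 := by
    intro γ hγ
    have : ray γ ∈ (fun x : S3 => g (x : E4)) '' tile τ s := by
      rw [hg]
      exact ⟨⟨ray γ, by rw [mem_sphere_zero_iff_norm, norm_ray]⟩, hγ, rfl⟩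
    obtain ⟨x, hx, hgx⟩ := this
    replace hgx : g (x : E4) = ray γ := hgx
    have orth : ∀ a b : ℝ, ‖vec a b 0 0‖ = 1 → inner ℝ (x : E4) (vec a b 0 0) = 0 := by
      intro a b hab
      obtain ⟨h2, h3⟩ := axis a b hab
      rw [← g.inner_map_map, hgx, inner_coord, h2, h3]
      simp [ray]
    refine ⟨x, hx, hgx, ?_, ?_⟩
    · simpa [inner_coord] using orth 1 0 (norm_eq_one_of_coord (by norm_num))
    · simpa [inner_coord] using orth 0 1 (norm_eq_one_of_coord (by norm_num))
  -- Points of the dual circle have both axis coordinates zero and so lie over both regions: this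
  -- end comes from the base sector, the other one from the shifted sector.
  obtain ⟨x, hx, gx, x0, x1⟩ := pull τ' (Or.inl ⟨Or.inl le_rfl, (turn_ray_self _).ge,
    (turn_ray_neg (by linarith) (by linarith)).le⟩)
  obtain ⟨y, hy, gy, y0, y1⟩ := pull (τ' + s' + Real.pi / 6) (Or.inr ⟨⟨le_rfl, le_rfl⟩,
    (turn_ray_pos (by linarith) (by linarith)).le, (turn_ray_self _).le⟩)
  have h1 := cos_le_inner_of_mem hs (hss.trans hs') hx hy x0 x1 y0 y1
  rw [← g.inner_map_map, gx, gy] at h1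
  have h2 : inner ℝ (ray τ') (ray (τ' + s' + Real.pi / 6)) = Real.cos (s' + Real.pi / 6) := by
    rw [show s' + Real.pi / 6 = τ' + s' + Real.pi / 6 - τ' by ring, Real.cos_sub, inner_coord]
    simp [ray]; ring
  rw [h2] at h1
  have h3 : Real.cos (s' + Real.pi / 6) < Real.cos (s + Real.pi / 6) :=
    Real.strictAntiOn_cos ⟨by linarith, by linarith⟩ ⟨by linarith, by linarith⟩ (by linarith)
  linarith

/-! ### The deformation. -/

/-- The shift of the tiles at the moment `t`. -/
noncomputable def shift (t : unitInterval) : ℝ := (1 + (t : ℝ)) * (Real.pi / 18)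

/-- The shift runs from `π / 18` to `π / 9`, inside the range `(0, π / 6)` where the combinatorial
type is constant. -/
lemma shift_pos (t : unitInterval) : 0 < shift t := by
  have := t.2.1
  have := Real.pi_pos
  unfold shift; positivity

lemma shift_lt (t : unitInterval) : shift t < Real.pi / 6 := by
  have := t.2.2
  have := Real.pi_pos
  unfold shift; nlinarith

lemma continuous_shift : Continuous shift := by
  unfold shift; fun_prop

end FlexibleTiling

open FlexibleTiling

/-- There are twelve polyhedra `K i t` in `S³`, depending on a parameter `t ∈ [0, 1]`, such that:
the boundary surface of each of them keeps its combinatorial structure `F` and has vertices `p i t v`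
that move continuously; all dihedral angles of each of them are independent of `t`; for every `t`
they are mutually congruent and tile `S³`; and the deformation of the tiles is nontrivial, that is,
it is not generated by isometries of `S³`. -/
theorem theorem6 :
    ∃ (n : ℕ) (F : Finset (Finset (Fin n)))
      (p : Fin 12 → unitInterval → Fin n → S3) (K : Fin 12 → unitInterval → Set S3),
      IsTriangulatedSphere F ∧
      (∀ i v, Continuous fun t => p i t v) ∧
      (∀ i t, IsPolyhedralTile F (p i t) (K i t)) ∧
      (∀ i, ∀ a b c d : Fin n, c ≠ d → {a, b, c} ∈ F → {a, b, d} ∈ F →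
        ∃ α : ℝ, ∀ t, HasDihedralAngle (K i t) (p i t a) (p i t b) (p i t c) (p i t d) α) ∧
      (∀ t, IsTiling fun i => K i t) ∧
      (∀ t i j, CongruentSets (K i t) (K j t)) ∧
      (∃ t, ∀ i, ¬ CongruentSets (K i 0) (K i t)) := by
  refine ⟨7, faces, fun i t => vertex (i * (Real.pi / 6)) (shift t),
    fun i t => tile (i * (Real.pi / 6)) (shift t), isTriangulatedSphere_faces, ?_, ?_, ?_, ?_, ?_, ?_⟩
  · exact fun i v => (continuous_vertex _ v).comp continuous_shift
  · exact fun i t => isPolyhedralTile (shift_pos t) (shift_lt t)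
  · intro i a b c d hcd hc hd
    obtain ⟨α, hα⟩ := exists_dihedralAngle hcd hc hd
    exact ⟨α, fun t => hα _ _ (shift_pos t) (shift_lt t)⟩
  · exact fun t => isTiling_tile (shift t)
  · exact fun t i j => congruentSets_tile _ _ _
  -- The final moment has a strictly larger shift than the initial one.
  · refine ⟨1, fun i => not_congruentSets_tile (shift_pos 0) ?_ (shift_lt 1)⟩
    have := Real.pi_pos
    simp only [shift, Set.Icc.coe_zero, Set.Icc.coe_one]
    linarith
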